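/- Let $X\in\mathbb R^{m\times p}$ be a fixed matrix of rank $q<m$, let $A\in\mathbb R^{p\times n}$ ($n,p\ge 1$), and let $Y=XA+E$, where $E$ is a random $m\times n$ matrix with independent $N(0,\sigma^2)$ entries, $\sigma>0$. Let $P$ be the orthogonal projection matrix onto the column space of $X$ and put $$S^2=\frac{\|Y-PY\|_F^2}{n(m-q)}.$$ For $\theta>0$, $\xi>0$, $0<\delta<1$ and $B\in\mathbb R^{p\times n}$ of rank $r(B)$ put $$\mathrm{pen}(B)=\frac{1+\theta}{1-\delta}(1+\xi)^2(\sqrt n+\sqrt q)^2S^2\,r(B),$$ and let $\hat A$ be a (measurable) minimizer of $\|Y-XB\|_F^2+\mathrm{pen}(B)$ over all $p\times n$ matrices $B$. Let $d_1(XA)\ge d_2(XA)\ge\dots$ be the singular values of $XA$ and $c(\theta)=1+2/\theta$. Then $\|X\hat A-XA\|_F^2$ is integrable and $$\begin{aligned}\mathbb E\big[\|X\hat A-XA\|_F^2\big]\le{}&\min_{1\le k\le\min(n,p)}\Big[c^2(\theta)\sum_{j>k}d_j^2(XA)+2\,\frac{1+\theta}{1-\delta}\,c(\theta)(1+\xi)^2\sigma^2(\sqrt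 n+\sqrt q)^2k\Big]\\&+4(1+\theta)c(\theta)\min(n,p)\,\sigma^2(1+\xi^{-1})\exp\Big(-\frac{\xi^2(n+q)}2\Big)\\&+4(1+\theta)c(\theta)\min(n,p)\,\sigma^2\Big(2+(\sqrt n+\sqrt q)^2+(\sqrt n+\sqrt q)\sqrt{2\pi}\Big)\exp\Big(-\frac{\delta^2n(m-q)}{4(1+\delta)}\Big).\end{aligned}$$ -/

import Mathlib

open MeasureTheory ProbabilityTheory
open scoped NNReal

noncomputable section

/-- The squared Frobenius norm `‖C‖_F² = ∑ i, ∑ j, C i j ^ 2`. -/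
def frobSq {m n : ℕ} (C : Matrix (Fin m) (Fin n) ℝ) : ℝ :=
  ∑ i, ∑ j, C i j ^ 2

/-- The matrix of the orthogonal projection of `ℝ^m` (Euclidean inner product) onto the
column space of `X`. -/
def colProj {m p : ℕ} (X : Matrix (Fin m) (Fin p) ℝ) : Matrix (Fin m) (Fin m) ℝ :=
  Matrix.toEuclideanLin.symm
    ((LinearMap.range (Matrix.toEuclideanLin X)).starProjection.toLinearMap)

/-- `∑_{j > k} d_j²(C)`, where `d_1(C) ≥ d_2(C) ≥ …` are the singular values of the `m × n`
matrix `C`. Mathlib's sequence is indexed from `0`, so that `d_j` is its entry `j - 1`, and its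
entries from index `n` on vanish. -/
def tailSingSq {m n : ℕ} (C : Matrix (Fin m) (Fin n) ℝ) (k : ℕ) : ℝ :=
  ∑ i ∈ Finset.Ico k n, (Matrix.toEuclideanLin C).singularValues i ^ 2

/-- The variance estimator `S² = ‖Y - P Y‖_F² / (m n - q n)`, with `q` the rank of `X` and `P` the
projection onto the column space of `X`. -/
def varEst {m n p : ℕ} (X : Matrix (Fin m) (Fin p) ℝ) (Y : Matrix (Fin m) (Fin n) ℝ) : ℝ :=
  frobSq (Y - colProj X * Y) / ((m : ℝ) * n - (X.rank : ℝ) * n)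

/-- The data-adaptive penalty
`pen(B) = (1 + θ) / (1 - δ) * (1 + ξ)² * (√n + √q)² * S² * r(B)`. -/
def adaptivePen {m n p : ℕ} (θ ξ δ : ℝ) (X : Matrix (Fin m) (Fin p) ℝ)
    (Y : Matrix (Fin m) (Fin n) ℝ) (B : Matrix (Fin p) (Fin n) ℝ) : ℝ :=
  (1 + θ) / (1 - δ) * (1 + ξ) ^ 2 * (√(n : ℝ) + √(X.rank : ℝ)) ^ 2 * varEst X Y * (B.rank : ℝ)

/-- `Ahat` is a rank selection estimate for the data `(X, Y)` with the data-adaptive penalty: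
it minimizes `‖Y - X B‖_F² + pen(B)` over all `p × n` matrices `B`. -/
def IsAdaptiveRSC {m n p : ℕ} (θ ξ δ : ℝ) (X : Matrix (Fin m) (Fin p) ℝ)
    (Y : Matrix (Fin m) (Fin n) ℝ) (Ahat : Matrix (Fin p) (Fin n) ℝ) : Prop :=
  ∀ B : Matrix (Fin p) (Fin n) ℝ,
    frobSq (Y - X * Ahat) + adaptivePen θ ξ δ X Y Ahat ≤
      frobSq (Y - X * B) + adaptivePen θ ξ δ X Y B

end

/-- The law of a family of independent standard normal variables indexed by `κ`. -/
noncomputable def gaussPi (κ : Type*) [Fintype κ] : Measure (κ → ℝ) :=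
  Measure.pi fun _ => gaussianReal 0 1

instance gaussPi.instIsProbabilityMeasure (κ : Type*) [Fintype κ] :
    IsProbabilityMeasure (gaussPi κ) := by
  unfold gaussPi; infer_instance

theorem integrable_exp_mul_abs_gaussianReal (L : ℝ) :
    Integrable (fun x : ℝ => Real.exp (L * |x|)) (gaussianReal 0 1) := by
  have h := ((integrable_exp_mul_gaussianReal (μ := 0) (v := 1) L).add
    (integrable_exp_mul_gaussianReal (μ := 0) (v := 1) (-L)))
  refine h.mono' (by fun_prop) (ae_of_all _ fun x => ?_)
  rw [Real.norm_eq_abs, Real.abs_exp]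
  simp only [Pi.add_apply]
  rcases abs_cases x with ⟨h, _⟩ | ⟨h, _⟩ <;> rw [h]
  · linarith [Real.exp_pos (-L * x)]
  · have : L * -x = -L * x := by ring
    rw [this]; linarith [Real.exp_pos (L * x)]

section GaussPi

variable {κ : Type*} [Fintype κ]

theorem integrable_exp_sum_abs_gaussPi (L : ℝ) :
    Integrable (fun x : κ → ℝ => Real.exp (L * ∑ k, |x k|)) (gaussPi κ) := by
  have h := Integrable.fintype_prod (μ := fun _ : κ => gaussianReal 0 1)
    (f := fun _ : κ => fun x : ℝ => Real.exp (L * |x|))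
    (fun _ => integrable_exp_mul_abs_gaussianReal L)
  simp only [← Real.exp_sum, ← Finset.mul_sum] at h
  exact h

theorem integrable_gaussPi_of_exp_growth {f : (κ → ℝ) → ℝ} (hf : Measurable f) (C L : ℝ)
    (h : ∀ x, |f x| ≤ C * Real.exp (L * ∑ k, |x k|)) : Integrable f (gaussPi κ) :=
  ((integrable_exp_sum_abs_gaussPi L).const_mul C).mono' hf.aestronglyMeasurable
    (ae_of_all _ h)

theorem sum_abs_le_exp (x : κ → ℝ) : ∑ k, |x k| ≤ Real.exp (∑ k, |x k|) := by
  linarith [Real.add_one_le_exp (∑ k, |x k|)]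

theorem abs_apply_le_exp (x : κ → ℝ) (k : κ) : |x k| ≤ Real.exp (∑ k, |x k|) :=
  (Finset.single_le_sum (f := fun k => |x k|) (fun _ _ => abs_nonneg _)
    (Finset.mem_univ k)).trans (sum_abs_le_exp x)

theorem integrable_coord_mul_gaussPi_of_exp_growth {f : (κ → ℝ) → ℝ} (hf : Measurable f)
    (C L : ℝ) (h : ∀ x, |f x| ≤ C * Real.exp (L * ∑ k, |x k|)) (k : κ) :
    Integrable (fun x => x k * f x) (gaussPi κ) := by
  refine integrable_gaussPi_of_exp_growth ((measurable_pi_apply k).mul hf) C (1 + L) fun x => ?_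
  rw [abs_mul, add_mul, one_mul, Real.exp_add]
  calc _ ≤ Real.exp (∑ k, |x k|) * (C * Real.exp (L * ∑ k, |x k|)) :=
        mul_le_mul (abs_apply_le_exp x k) (h x) (abs_nonneg _) (Real.exp_pos _).le
    _ = _ := by ring

theorem measurePreserving_update_gaussPi [DecidableEq κ] (k : κ) :
    MeasurePreserving (fun z : (κ → ℝ) × ℝ => Function.update z.1 k z.2)
      ((gaussPi κ).prod (gaussianReal 0 1)) (gaussPi κ) := by
  have hm : Measurable (fun z : (κ → ℝ) × ℝ => Function.update z.1 k z.2) := by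
    refine measurable_pi_iff.2 fun i => ?_
    by_cases h : i = k
    · subst h; simpa using measurable_snd
    · simp only [Function.update_of_ne h]
      fun_prop
  refine ⟨hm, ?_⟩
  symm
  refine Measure.pi_eq fun s hs => ?_
  rw [Measure.map_apply hm (MeasurableSet.univ_pi hs)]
  have : (fun z : (κ → ℝ) × ℝ => Function.update z.1 k z.2) ⁻¹' (Set.univ.pi s)
      = (Set.univ.pi (Function.update s k Set.univ)) ×ˢ (s k) := by
    ext z
    simp only [Set.mem_preimage, Set.mem_pi, Set.mem_univ, true_imp_iff, Set.mem_prod]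
    constructor
    · intro h
      refine ⟨fun i => ?_, by simpa using h k⟩
      by_cases hi : i = k
      · subst hi; simp
      · simpa [Function.update_of_ne hi] using h i
    · rintro ⟨h, h'⟩ i
      by_cases hi : i = k
      · subst hi; simpa using h'
      · simpa [Function.update_of_ne hi] using h i
  rw [this, Measure.prod_prod, gaussPi, Measure.pi_pi,
    ← Finset.mul_prod_erase _ _ (Finset.mem_univ k),
    ← Finset.mul_prod_erase (Finset.univ) (fun i => gaussianReal 0 1 (s i)) (Finset.mem_univ k)]
  simp only [Function.update_self, measure_univ, one_mul]
  rw [mul_comm]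
  congr 1
  refine Finset.prod_congr rfl fun i hi => ?_
  rw [Function.update_of_ne (Finset.ne_of_mem_erase hi)]

end GaussPi

theorem integrable_gaussianPDFReal_mul_iff (f : ℝ → ℝ) :
    Integrable f (gaussianReal 0 1) ↔ Integrable (fun x => gaussianPDFReal 0 1 x * f x) := by
  rw [gaussianReal_of_var_ne_zero 0 one_ne_zero, integrable_withDensity_iff_integrable_smul'
    (measurable_gaussianPDF 0 1) (ae_of_all _ fun x => gaussianPDF_lt_top)]
  simp [toReal_gaussianPDF]

theorem hasDerivAt_gaussianPDFReal (x : ℝ) :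
    HasDerivAt (gaussianPDFReal 0 1) (-x * gaussianPDFReal 0 1 x) x := by
  unfold gaussianPDFReal
  have h : HasDerivAt (fun x : ℝ => -(x - 0) ^ 2 / (2 * ((1 : ℝ≥0) : ℝ))) (-x) x := by
    have := (((hasDerivAt_id x).sub_const 0).pow 2).neg.div_const (2 * ((1 : ℝ≥0) : ℝ))
    convert! this using 1
    simp; ring
  convert! (h.exp.const_mul ((√(2 * Real.pi * ((1 : ℝ≥0) : ℝ)))⁻¹)) using 1
  ring

/-- Gaussian integration by parts in dimension one. -/
theorem integral_mul_gaussianReal_eq_integral_deriv {f f' : ℝ → ℝ}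
    (hd : ∀ x, HasDerivAt f (f' x) x) (hf : Integrable f (gaussianReal 0 1))
    (hf' : Integrable f' (gaussianReal 0 1))
    (hxf : Integrable (fun x => x * f x) (gaussianReal 0 1)) :
    ∫ x, x * f x ∂(gaussianReal 0 1) = ∫ x, f' x ∂(gaussianReal 0 1) := by
  rw [integral_gaussianReal_eq_integral_smul one_ne_zero,
    integral_gaussianReal_eq_integral_smul one_ne_zero]
  rw [integrable_gaussianPDFReal_mul_iff] at hf hf' hxf
  have := integral_mul_deriv_eq_deriv_mul_of_integrable (u := f) (u' := f')
    (v := gaussianPDFReal 0 1) (v' := fun x => -x * gaussianPDFReal 0 1 x)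
    (fun x _ => hd x) (fun x _ => hasDerivAt_gaussianPDFReal x)
    (by convert hxf.neg using 1; ext x; simp; ring)
    (by convert hf' using 1; ext x; simp; ring)
    (by convert hf using 1; ext x; simp; ring)
  calc ∫ x, gaussianPDFReal 0 1 x • (x * f x)
      = -∫ x, f x * (-x * gaussianPDFReal 0 1 x) := by
        rw [← integral_neg]; congr 1; ext x; simp; ring
    _ = ∫ x, gaussianPDFReal 0 1 x • f' x := by
        rw [this, neg_neg]; congr 1; ext x; simp; ring

/-- Gaussian integration by parts along a coordinate. -/
theorem integral_coord_mul_gaussPi {κ : Type*} [Fintype κ] [DecidableEq κ] (k : κ)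
    {f f' : (κ → ℝ) → ℝ}
    (hd : ∀ x t, HasDerivAt (fun s => f (Function.update x k s)) (f' (Function.update x k t)) t)
    (hf : Integrable f (gaussPi κ)) (hf' : Integrable f' (gaussPi κ))
    (hxf : Integrable (fun x => x k * f x) (gaussPi κ)) :
    ∫ x, x k * f x ∂(gaussPi κ) = ∫ x, f' x ∂(gaussPi κ) := by
  have hmp := measurePreserving_update_gaussPi k
  have key : ∀ g : (κ → ℝ) → ℝ, Integrable g (gaussPi κ) →
      Integrable (fun z : (κ → ℝ) × ℝ => g (Function.update z.1 k z.2))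
        ((gaussPi κ).prod (gaussianReal 0 1)) ∧
      ∫ x, g x ∂(gaussPi κ) =
        ∫ x, ∫ t, g (Function.update x k t) ∂(gaussianReal 0 1) ∂(gaussPi κ) := by
    intro g hg
    have h1 : Integrable (fun z : (κ → ℝ) × ℝ => g (Function.update z.1 k z.2))
        ((gaussPi κ).prod (gaussianReal 0 1)) := hmp.integrable_comp_of_integrable hg
    refine ⟨h1, ?_⟩
    rw [← integral_prod _ h1]
    conv_lhs => rw [← hmp.map_eq]
    rw [integral_map hmp.measurable.aemeasurable]
    rw [hmp.map_eq]; exact hg.aestronglyMeasurable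
  obtain ⟨h1, -⟩ := key f hf
  obtain ⟨h2, e2⟩ := key f' hf'
  obtain ⟨h3, e3⟩ := key _ hxf
  rw [e2, e3]
  refine integral_congr_ae ?_
  filter_upwards [h1.prod_right_ae, h2.prod_right_ae, h3.prod_right_ae] with x a b c
  simp only [Function.update_self] at c ⊢
  exact integral_mul_gaussianReal_eq_integral_deriv (fun t => hd x t) a b c

section SmoothNorm

variable {κ : Type*} [Fintype κ]

/-- The smoothed Euclidean norm `√(ε + ∑ k, x k ^ 2)`. -/
noncomputable def smoothNorm (ε : ℝ) (x : κ → ℝ) : ℝ := √(ε + ∑ k, x k ^ 2)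

theorem smoothNorm_sq {ε : ℝ} (hε : 0 ≤ ε) (x : κ → ℝ) :
    smoothNorm ε x ^ 2 = ε + ∑ k, x k ^ 2 :=
  Real.sq_sqrt (add_nonneg hε (Finset.sum_nonneg fun _ _ => sq_nonneg _))

theorem smoothNorm_pos {ε : ℝ} (hε : 0 < ε) (x : κ → ℝ) : 0 < smoothNorm ε x :=
  Real.sqrt_pos.2 (add_pos_of_pos_of_nonneg hε (Finset.sum_nonneg fun _ _ => sq_nonneg _))

theorem measurable_smoothNorm (ε : ℝ) : Measurable (smoothNorm (κ := κ) ε) := by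
  unfold smoothNorm; fun_prop

theorem smoothNorm_le {ε : ℝ} (hε : 0 ≤ ε) (x : κ → ℝ) :
    smoothNorm ε x ≤ √ε + ∑ k, |x k| := by
  have hS : 0 ≤ ∑ k, |x k| := Finset.sum_nonneg fun _ _ => abs_nonneg _
  refine Real.sqrt_le_iff.2 ⟨by positivity, ?_⟩
  have h : ∑ k, x k ^ 2 ≤ (∑ k, |x k|) ^ 2 := by
    rw [sq (∑ k, |x k|), Finset.mul_sum]
    refine Finset.sum_le_sum fun k _ => ?_
    rw [← sq_abs, sq]
    exact mul_le_mul_of_nonneg_right (Finset.single_le_sum (f := fun k => |x k|)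
      (fun _ _ => abs_nonneg _) (Finset.mem_univ k)) (abs_nonneg _)
  nlinarith [Real.sq_sqrt hε, mul_nonneg (Real.sqrt_nonneg ε) hS]

theorem exp_mul_smoothNorm_le {ε L : ℝ} (hε : 0 ≤ ε) (hL : 0 ≤ L) (x : κ → ℝ) :
    Real.exp (L * smoothNorm ε x) ≤ Real.exp (L * √ε) * Real.exp (L * ∑ k, |x k|) := by
  rw [← Real.exp_add, ← mul_add]
  exact Real.exp_le_exp.2 (mul_le_mul_of_nonneg_left (smoothNorm_le hε x) hL)

theorem integrable_exp_mul_smoothNorm {ε : ℝ} (hε : 0 ≤ ε) (t : ℝ) :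
    Integrable (fun x : κ → ℝ => Real.exp (t * smoothNorm ε x)) (gaussPi κ) := by
  refine integrable_gaussPi_of_exp_growth
    ((measurable_smoothNorm ε).const_mul t).exp (Real.exp (|t| * √ε)) |t| fun x => ?_
  rw [Real.abs_exp]
  refine le_trans (Real.exp_le_exp.2 ?_) (exp_mul_smoothNorm_le hε (abs_nonneg t) x)
  exact mul_le_mul_of_nonneg_right (le_abs_self t) (Real.sqrt_nonneg _)

theorem integrableExpSet_smoothNorm {ε : ℝ} (hε : 0 ≤ ε) :
    integrableExpSet (smoothNorm (κ := κ) ε) (gaussPi κ) = Set.univ :=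
  Set.eq_univ_of_forall fun t => integrable_exp_mul_smoothNorm hε t

theorem mem_interior_integrableExpSet_smoothNorm {ε : ℝ} (hε : 0 ≤ ε) (t : ℝ) :
    t ∈ interior (integrableExpSet (smoothNorm (κ := κ) ε) (gaussPi κ)) := by
  rw [integrableExpSet_smoothNorm hε, interior_univ]; trivial

theorem abs_apply_le_smoothNorm {ε : ℝ} (hε : 0 ≤ ε) (x : κ → ℝ) (k : κ) :
    |x k| ≤ smoothNorm ε x := by
  refine Real.le_sqrt_of_sq_le ?_
  rw [sq_abs]
  have := Finset.single_le_sum (f := fun k => x k ^ 2) (fun _ _ => sq_nonneg _)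
    (Finset.mem_univ k)
  linarith

theorem hasDerivAt_smoothNorm_update [DecidableEq κ] {ε : ℝ} (hε : 0 < ε) (x : κ → ℝ) (k : κ)
    (t : ℝ) :
    HasDerivAt (fun s => smoothNorm ε (Function.update x k s))
      (t / smoothNorm ε (Function.update x k t)) t := by
  have hsum : ∀ s, ε + ∑ j, (Function.update x k s) j ^ 2
      = s ^ 2 + (ε + ∑ j ∈ Finset.univ.erase k, x j ^ 2) := by
    intro s
    rw [← Finset.add_sum_erase _ _ (Finset.mem_univ k)]
    have : ∑ j ∈ Finset.univ.erase k, (Function.update x k s) j ^ 2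
        = ∑ j ∈ Finset.univ.erase k, x j ^ 2 :=
      Finset.sum_congr rfl fun j hj => by rw [Function.update_of_ne (Finset.ne_of_mem_erase hj)]
    rw [this]; simp; ring
  have hne : ε + ∑ j, (Function.update x k t) j ^ 2 ≠ 0 :=
    (add_pos_of_pos_of_nonneg hε (Finset.sum_nonneg fun _ _ => sq_nonneg _)).ne'
  have h1 : HasDerivAt (fun s => ε + ∑ j, (Function.update x k s) j ^ 2) (2 * t) t := by
    simp only [hsum]
    simpa using ((hasDerivAt_id t).pow 2).add_const (ε + ∑ j ∈ Finset.univ.erase k, x j ^ 2)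
  convert! h1.sqrt hne using 1
  unfold smoothNorm
  rw [mul_div_mul_left _ _ two_ne_zero]

theorem integral_coord_sq_mul_exp_smoothNorm [DecidableEq κ] {ε : ℝ} (hε : 0 < ε) (t : ℝ)
    (k : κ) :
    ∫ x, x k * (x k * Real.exp (t * smoothNorm ε x)) ∂(gaussPi κ) =
      ∫ x, (1 + t * (x k ^ 2 / smoothNorm ε x)) * Real.exp (t * smoothNorm ε x) ∂(gaussPi κ) ∧
    Integrable (fun x => x k * (x k * Real.exp (t * smoothNorm ε x))) (gaussPi κ) ∧
    Integrable (fun x => (1 + t * (x k ^ 2 / smoothNorm ε x)) * Real.exp (t * smoothNorm ε x))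
      (gaussPi κ) := by
  have hX := measurable_smoothNorm (κ := κ) ε
  have hexp : ∀ x : κ → ℝ, Real.exp (t * smoothNorm ε x) ≤ Real.exp (|t| * smoothNorm ε x) :=
    fun x => Real.exp_le_exp.2 (mul_le_mul_of_nonneg_right (le_abs_self t) (Real.sqrt_nonneg _))
  have hm : Measurable fun x : κ → ℝ => x k * Real.exp (t * smoothNorm ε x) := by fun_prop
  have hm' : Measurable fun x : κ → ℝ =>
      (1 + t * (x k ^ 2 / smoothNorm ε x)) * Real.exp (t * smoothNorm ε x) := by fun_prop
  have hb : ∀ x : κ → ℝ, |x k * Real.exp (t * smoothNorm ε x)| ≤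
      Real.exp ((1 + |t|) * √ε) * Real.exp ((1 + |t|) * ∑ k, |x k|) := by
    intro x
    refine le_trans ?_ (exp_mul_smoothNorm_le hε.le (by positivity) x)
    rw [abs_mul, Real.abs_exp, add_mul, one_mul, Real.exp_add]
    refine mul_le_mul ?_ (hexp x) (Real.exp_pos _).le (Real.exp_pos _).le
    exact (abs_apply_le_smoothNorm hε.le x k).trans
      (by linarith [Real.add_one_le_exp (smoothNorm ε x)])
  have hb' : ∀ x : κ → ℝ,
      |(1 + t * (x k ^ 2 / smoothNorm ε x)) * Real.exp (t * smoothNorm ε x)| ≤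
      Real.exp ((|t| + |t|) * √ε) * Real.exp ((|t| + |t|) * ∑ k, |x k|) := by
    intro x
    refine le_trans ?_ (exp_mul_smoothNorm_le hε.le (by positivity) x)
    rw [abs_mul, Real.abs_exp, add_mul, Real.exp_add]
    refine mul_le_mul ?_ (hexp x) (Real.exp_pos _).le (Real.exp_pos _).le
    have hle : x k ^ 2 / smoothNorm ε x ≤ smoothNorm ε x := by
      rw [div_le_iff₀ (smoothNorm_pos hε x), ← sq, ← sq_abs]
      exact pow_le_pow_left₀ (abs_nonneg _) (abs_apply_le_smoothNorm hε.le x k) 2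
    calc |1 + t * (x k ^ 2 / smoothNorm ε x)| ≤ |1| + |t * (x k ^ 2 / smoothNorm ε x)| :=
          abs_add_le _ _
      _ = 1 + |t| * (x k ^ 2 / smoothNorm ε x) := by
          rw [abs_one, abs_mul, abs_of_nonneg (div_nonneg (sq_nonneg _) (smoothNorm_pos hε x).le)]
      _ ≤ 1 + |t| * smoothNorm ε x := by gcongr
      _ ≤ _ := by linarith [Real.add_one_le_exp (|t| * smoothNorm ε x)]
  have i1 := integrable_gaussPi_of_exp_growth hm _ _ hb
  have i2 := integrable_gaussPi_of_exp_growth hm' _ _ hb'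
  have i3 := integrable_coord_mul_gaussPi_of_exp_growth hm _ _ hb k
  refine ⟨integral_coord_mul_gaussPi k (fun x s => ?_) i1 i2 i3, i3, i2⟩
  simp only [Function.update_self]
  convert! (hasDerivAt_id s).mul (((hasDerivAt_smoothNorm_update hε x k s).const_mul t).exp) using 1
  simp only [id_eq]
  ring

theorem integral_smoothNorm_sq_mul_exp_le {ε t : ℝ} (hε : 0 < ε) (ht : 0 ≤ t) :
    ∫ x, smoothNorm ε x ^ 2 * Real.exp (t * smoothNorm ε x) ∂(gaussPi κ) ≤
      (Fintype.card κ + ε) * mgf (smoothNorm ε) (gaussPi κ) t +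
        t * ∫ x, smoothNorm ε x * Real.exp (t * smoothNorm ε x) ∂(gaussPi κ) := by
  classical
  have hI := fun k : κ => integral_coord_sq_mul_exp_smoothNorm hε t k
  have hi0 := integrable_exp_mul_smoothNorm (κ := κ) hε.le t
  have hi1 : Integrable (fun x : κ → ℝ => smoothNorm ε x * Real.exp (t * smoothNorm ε x))
      (gaussPi κ) := by
    have := integrable_pow_mul_exp_of_mem_interior_integrableExpSet
      (mem_interior_integrableExpSet_smoothNorm (κ := κ) hε.le t) 1
    simpa using this
  have e1 : ∀ x : κ → ℝ, smoothNorm ε x ^ 2 * Real.exp (t * smoothNorm ε x)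
      = ε * Real.exp (t * smoothNorm ε x) +
        ∑ k, x k * (x k * Real.exp (t * smoothNorm ε x)) := by
    intro x
    rw [smoothNorm_sq hε.le, add_mul, Finset.sum_mul]
    congr 1
    exact Finset.sum_congr rfl fun k _ => by ring
  simp only [e1]
  rw [integral_add (hi0.const_mul ε) (integrable_finsetSum _ fun k _ => (hI k).2.1),
    integral_finsetSum _ fun k _ => (hI k).2.1, Finset.sum_congr rfl fun k _ => (hI k).1,
    ← integral_finsetSum _ fun k _ => (hI k).2.2, integral_const_mul, add_mul, add_comm,
    add_right_comm]
  refine add_le_add ?_ le_rfl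
  rw [mgf, ← integral_const_mul, ← integral_const_mul, ← integral_add (hi0.const_mul _)
    (hi1.const_mul _)]
  refine integral_mono (integrable_finsetSum _ fun k _ => (hI k).2.2)
    ((hi0.const_mul _).add (hi1.const_mul _)) fun x => ?_
  simp only
  rw [← Finset.sum_mul, ← mul_assoc, ← add_mul]
  refine mul_le_mul_of_nonneg_right ?_ (Real.exp_pos _).le
  rw [Finset.sum_add_distrib, ← Finset.mul_sum, ← Finset.sum_div]
  simp only [Finset.sum_const, Finset.card_univ, nsmul_eq_mul, mul_one]
  gcongr
  rw [div_le_iff₀ (smoothNorm_pos hε x), ← sq, smoothNorm_sq hε.le]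
  linarith

/-- The Laplace transform of the (smoothed) Euclidean norm of a standard Gaussian vector. -/
theorem mgf_smoothNorm_le {ε t : ℝ} (hε : 0 < ε) (ht : 0 ≤ t) :
    mgf (smoothNorm ε) (gaussPi κ) t ≤
      Real.exp (t * √(Fintype.card κ + ε) + t ^ 2 / 2) := by
  set a : ℝ := √(Fintype.card κ + ε)
  set X : (κ → ℝ) → ℝ := smoothNorm ε
  have hi0 := integrable_exp_mul_smoothNorm (κ := κ) hε.le
  have hpos : ∀ s, 0 < mgf X (gaussPi κ) s := fun s => mgf_pos (hi0 s)
  have hd : ∀ s, HasDerivAt (mgf X (gaussPi κ)) (∫ x, X x * Real.exp (s * X x) ∂(gaussPi κ)) s :=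
    fun s => hasDerivAt_mgf (mem_interior_integrableExpSet_smoothNorm hε.le s)
  have hpw : ∀ s : ℝ, ∀ j : ℕ, Integrable (fun x => X x ^ j * Real.exp (s * X x)) (gaussPi κ) :=
    fun s j => integrable_pow_mul_exp_of_mem_interior_integrableExpSet
      (mem_interior_integrableExpSet_smoothNorm (κ := κ) hε.le s) j
  have hd' : ∀ s, HasDerivAt (fun s => Real.log (mgf X (gaussPi κ) s) - (s * a + s ^ 2 / 2))
      ((∫ x, X x * Real.exp (s * X x) ∂(gaussPi κ)) / mgf X (gaussPi κ) s - (a + s)) s := by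
    intro s
    refine ((hd s).log (hpos s).ne').sub ?_
    convert! ((hasDerivAt_id s).mul_const a).add (((hasDerivAt_id s).pow 2).div_const 2) using 1
    simp
  have hle : ∀ s, 0 ≤ s →
      (∫ x, X x * Real.exp (s * X x) ∂(gaussPi κ)) / mgf X (gaussPi κ) s - (a + s) ≤ 0 := by
    intro s hs
    set M := mgf X (gaussPi κ) s with hM
    set D := ∫ x, X x * Real.exp (s * X x) ∂(gaussPi κ) with hD
    set Q := ∫ x, X x ^ 2 * Real.exp (s * X x) ∂(gaussPi κ) with hQ
    have hQle : Q ≤ (Fintype.card κ + ε) * M + s * D := integral_smoothNorm_sq_mul_exp_le hε hs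
    have hMp : 0 < M := hpos s
    set l := D / M with hl
    have hDl : D = l * M := by rw [hl, div_mul_cancel₀ _ hMp.ne']
    have hvar : 0 ≤ Q - 2 * l * D + l ^ 2 * M := by
      have h1 := hpw s 1
      simp only [pow_one] at h1
      have h2 : Integrable (fun x => X x ^ 2 * Real.exp (s * X x) -
          2 * l * (X x * Real.exp (s * X x))) (gaussPi κ) := (hpw s 2).sub (h1.const_mul _)
      have h3 : Integrable (fun x => l ^ 2 * Real.exp (s * X x)) (gaussPi κ) :=
        (hi0 s).const_mul _
      have : Q - 2 * l * D + l ^ 2 * M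
          = ∫ x, (X x - l) ^ 2 * Real.exp (s * X x) ∂(gaussPi κ) := by
        rw [hQ, hD, hM, mgf, ← integral_const_mul, ← integral_const_mul,
          ← integral_sub (hpw s 2) (h1.const_mul _), ← integral_add h2 h3]
        congr 1; ext x; ring
      rw [this]
      exact integral_nonneg fun x => mul_nonneg (sq_nonneg _) (Real.exp_pos _).le
    have hquad : l ^ 2 ≤ a ^ 2 + s * l := by
      have ha : a ^ 2 = Fintype.card κ + ε := Real.sq_sqrt (by positivity)
      rw [ha]
      rw [hDl] at hQle hvar
      have : l ^ 2 * M ≤ ((Fintype.card κ + ε) + s * l) * M := by nlinarith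
      exact le_of_mul_le_mul_right this hMp
    have ha0 : 0 ≤ a := Real.sqrt_nonneg _
    by_contra! hcon
    nlinarith
  have hanti : AntitoneOn (fun s => Real.log (mgf X (gaussPi κ) s) - (s * a + s ^ 2 / 2))
      (Set.Ici 0) := by
    refine antitoneOn_of_deriv_nonpos (convex_Ici 0)
      (fun s _ => (hd' s).continuousAt.continuousWithinAt)
      (fun s _ => (hd' s).differentiableAt.differentiableWithinAt) fun s hs => ?_
    rw [(hd' s).deriv]
    rw [interior_Ici] at hs
    exact hle s (le_of_lt hs)
  have h0 := hanti Set.self_mem_Ici ht ht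
  simp only [mgf_zero, zero_mul, Real.log_one] at h0
  rw [← Real.log_le_iff_le_exp (hpos t)]
  simp at h0
  linarith

/-- `𝔼 exp (t ‖g‖) ≤ exp (t √d + t² / 2)` for a standard Gaussian vector `g` in dimension `d`. -/
theorem integral_exp_mul_norm_gaussPi_le {t : ℝ} (ht : 0 ≤ t) :
    ∫ x, Real.exp (t * smoothNorm 0 x) ∂(gaussPi κ) ≤
      Real.exp (t * √(Fintype.card κ) + t ^ 2 / 2) := by
  have h : ∀ ε : ℝ, 0 < ε → ∫ x, Real.exp (t * smoothNorm 0 x) ∂(gaussPi κ) ≤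
      Real.exp (t * √(Fintype.card κ + ε) + t ^ 2 / 2) := by
    intro ε hε
    refine le_trans ?_ (mgf_smoothNorm_le hε ht)
    refine integral_mono (integrable_exp_mul_smoothNorm le_rfl t)
      (integrable_exp_mul_smoothNorm hε.le t) fun x => ?_
    refine Real.exp_le_exp.2 (mul_le_mul_of_nonneg_left (Real.sqrt_le_sqrt ?_) ht)
    linarith
  have hlim : Filter.Tendsto (fun ε : ℝ => Real.exp (t * √(Fintype.card κ + ε) + t ^ 2 / 2))
      (nhdsWithin 0 (Set.Ioi 0)) (nhds (Real.exp (t * √(Fintype.card κ + 0) + t ^ 2 / 2))) := by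
    refine Filter.Tendsto.mono_left (Continuous.tendsto ?_ 0) nhdsWithin_le_nhds
    fun_prop
  rw [add_zero] at hlim
  refine ge_of_tendsto hlim ?_
  filter_upwards [self_mem_nhdsWithin] with ε hε using h ε hε

end SmoothNorm

/-- The linear image of `g` under the matrix `D`. -/
noncomputable def linVec {ι κ : Type*} [Fintype κ] (D : ι → κ → ℝ) (g : κ → ℝ) (i : ι) : ℝ := ∑ k, D i k * g k

theorem measurable_linVec {ι κ : Type*} [Fintype κ] (D : ι → κ → ℝ) (i : ι) : Measurable fun g => linVec D g i := by
  unfold linVec; fun_prop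

theorem abs_linVec_le {ι κ : Type*} [Fintype κ] {D : ι → κ → ℝ} {b : ℝ} (hD : ∀ i k, |D i k| ≤ b) (g : κ → ℝ) (i : ι) :
    |linVec D g i| ≤ b * ∑ k, |g k| := by
  refine (Finset.abs_sum_le_sum_abs _ _).trans ?_
  rw [Finset.mul_sum]
  refine Finset.sum_le_sum fun k _ => ?_
  rw [abs_mul]
  exact mul_le_mul_of_nonneg_right (hD i k) (abs_nonneg _)

section Comparison

variable {ι κ : Type*} [Fintype ι] [Fintype κ]

/-- The smooth maximum `(∑ i, exp (β * x i)) ^ α`. -/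
noncomputable def softPow (α β : ℝ) (x : ι → ℝ) : ℝ :=
  Real.exp (α * Real.log (∑ i, Real.exp (β * x i)))

/-- The softmax weights. -/
noncomputable def softWeight (β : ℝ) (x : ι → ℝ) (i : ι) : ℝ :=
  Real.exp (β * x i) / ∑ j, Real.exp (β * x j)

/-- The first partial derivatives of `softPow`. -/
noncomputable def softGrad (α β : ℝ) (x : ι → ℝ) (i : ι) : ℝ :=
  α * β * softWeight β x i * softPow α β x

/-- The second partial derivatives of `softPow`. -/
noncomputable def softHess [DecidableEq ι] (α β : ℝ) (x : ι → ℝ) (i j : ι) : ℝ :=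
  α * β ^ 2 * softPow α β x * softWeight β x i *
    ((if i = j then 1 else 0) + (α - 1) * softWeight β x j)

theorem softPow_pos (α β : ℝ) (x : ι → ℝ) : 0 < softPow α β x := Real.exp_pos _

theorem softWeight_nonneg (β : ℝ) (x : ι → ℝ) (i : ι) : 0 ≤ softWeight β x i :=
  div_nonneg (Real.exp_pos _).le (Finset.sum_nonneg fun _ _ => (Real.exp_pos _).le)

theorem softWeight_le_one (β : ℝ) (x : ι → ℝ) (i : ι) : softWeight β x i ≤ 1 :=
  div_le_one_of_le₀ (Finset.single_le_sum (f := fun i => Real.exp (β * x i))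
    (fun _ _ => (Real.exp_pos _).le) (Finset.mem_univ i))
    (Finset.sum_nonneg fun _ _ => (Real.exp_pos _).le)

theorem softHess_nonpos_of_ne [DecidableEq ι] {α β : ℝ} (hα : 0 ≤ α) (hα1 : α ≤ 1)
    (x : ι → ℝ) {i j : ι} (h : i ≠ j) : softHess α β x i j ≤ 0 := by
  unfold softHess
  rw [if_neg h, zero_add]
  exact mul_nonpos_of_nonneg_of_nonpos
    (mul_nonneg (mul_nonneg (by positivity) (softPow_pos α β x).le) (softWeight_nonneg β x i))
    (mul_nonpos_of_nonpos_of_nonneg (by linarith) (softWeight_nonneg β x j))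

theorem abs_softGrad_le {α β : ℝ} (hα : 0 ≤ α) (hβ : 0 ≤ β) (x : ι → ℝ) (i : ι) :
    |softGrad α β x i| ≤ α * β * softPow α β x := by
  have h0 := softWeight_nonneg β x i
  have h1 := softWeight_le_one β x i
  have hp := (softPow_pos α β x).le
  unfold softGrad
  rw [abs_of_nonneg (by positivity)]
  exact mul_le_mul_of_nonneg_right (mul_le_of_le_one_right (by positivity) h1) hp

theorem abs_softHess_le [DecidableEq ι] {α β : ℝ} (hα : 0 ≤ α) (hα1 : α ≤ 1) (x : ι → ℝ)
    (i j : ι) : |softHess α β x i j| ≤ α * β ^ 2 * 2 * softPow α β x := by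
  have h0 := softWeight_nonneg β x i
  have h1 := softWeight_le_one β x i
  have h0' := softWeight_nonneg β x j
  have h1' := softWeight_le_one β x j
  have hp := (softPow_pos α β x).le
  have hlast : |(if i = j then 1 else 0) + (α - 1) * softWeight β x j| ≤ 2 := by
    rw [abs_le]
    split_ifs <;> constructor <;> nlinarith
  unfold softHess
  rw [abs_mul, abs_of_nonneg (a := α * β ^ 2 * softPow α β x * softWeight β x i) (by positivity)]
  calc _ ≤ (α * β ^ 2 * softPow α β x * 1) * 2 := by gcongr
    _ = _ := by ring

theorem exp_le_softPow {α β : ℝ} (hα : 0 ≤ α) (x : ι → ℝ) (i : ι) :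
    Real.exp (α * β * x i) ≤ softPow α β x := by
  unfold softPow
  rw [mul_assoc]
  refine Real.exp_le_exp.2 (mul_le_mul_of_nonneg_left ?_ hα)
  rw [Real.le_log_iff_exp_le (Finset.sum_pos (fun _ _ => Real.exp_pos _) ⟨i, Finset.mem_univ i⟩)]
  exact Finset.single_le_sum (f := fun i => Real.exp (β * x i))
    (fun _ _ => (Real.exp_pos _).le) (Finset.mem_univ i)

theorem softPow_le [Nonempty ι] {α β R : ℝ} (hα : 0 ≤ α) (hβ : 0 ≤ β) (x : ι → ℝ)
    (h : ∀ i, x i ≤ R) :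
    softPow α β x ≤ Real.exp (α * Real.log (Fintype.card ι)) * Real.exp (α * β * R) := by
  unfold softPow
  rw [← Real.exp_add, mul_assoc, ← mul_add]
  refine Real.exp_le_exp.2 (mul_le_mul_of_nonneg_left ?_ hα)
  have hc : (0 : ℝ) < Fintype.card ι := by exact_mod_cast Fintype.card_pos
  rw [← Real.log_exp (β * R), ← Real.log_mul hc.ne' (Real.exp_pos _).ne']
  refine Real.log_le_log (Finset.sum_pos (fun _ _ => Real.exp_pos _) Finset.univ_nonempty) ?_
  calc _ ≤ ∑ _i : ι, Real.exp (β * R) := Finset.sum_le_sum fun i _ =>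
        Real.exp_le_exp.2 (mul_le_mul_of_nonneg_left (h i) hβ)
    _ = _ := by simp

section Deriv

variable [Nonempty ι] {x : ℝ → ι → ℝ} {x' : ι → ℝ} {t : ℝ}

theorem hasDerivAt_log_sum_exp (β : ℝ) (hx : ∀ i, HasDerivAt (fun s => x s i) (x' i) t) :
    HasDerivAt (fun s => Real.log (∑ i, Real.exp (β * x s i)))
      (β * ∑ i, softWeight β (x t) i * x' i) t := by
  have h1 : HasDerivAt (fun s => ∑ i, Real.exp (β * x s i))
      (∑ i, Real.exp (β * x t i) * (β * x' i)) t :=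
    HasDerivAt.fun_sum fun i _ => ((hx i).const_mul β).exp
  have hne : (∑ i, Real.exp (β * x t i)) ≠ 0 :=
    (Finset.sum_pos (fun _ _ => Real.exp_pos _) Finset.univ_nonempty).ne'
  convert! h1.log hne using 1
  rw [Finset.sum_div, Finset.mul_sum]
  refine Finset.sum_congr rfl fun i _ => ?_
  unfold softWeight
  ring

theorem hasDerivAt_softPow (α β : ℝ) (hx : ∀ i, HasDerivAt (fun s => x s i) (x' i) t) :
    HasDerivAt (fun s => softPow α β (x s)) (∑ i, softGrad α β (x t) i * x' i) t := by
  convert! ((hasDerivAt_log_sum_exp β hx).const_mul α).exp using 1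
  rw [Finset.mul_sum, Finset.mul_sum, Finset.mul_sum]
  refine Finset.sum_congr rfl fun i _ => ?_
  unfold softGrad softPow
  ring

theorem softWeight_eq_exp (β : ℝ) (x : ι → ℝ) (i : ι) :
    softWeight β x i = Real.exp (β * x i - Real.log (∑ j, Real.exp (β * x j))) := by
  rw [Real.exp_sub, Real.exp_log (Finset.sum_pos (fun _ _ => Real.exp_pos _) Finset.univ_nonempty),
    softWeight]

theorem hasDerivAt_softGrad [DecidableEq ι] (α β : ℝ)
    (hx : ∀ i, HasDerivAt (fun s => x s i) (x' i) t) (i : ι) :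
    HasDerivAt (fun s => softGrad α β (x s) i) (∑ j, softHess α β (x t) i j * x' j) t := by
  have hw : HasDerivAt (fun s => softWeight β (x s) i)
      (softWeight β (x t) i * (β * x' i - β * ∑ j, softWeight β (x t) j * x' j)) t := by
    simp only [softWeight_eq_exp]
    simpa only [softWeight_eq_exp] using
      (((hx i).const_mul β).fun_sub (hasDerivAt_log_sum_exp β hx)).exp
  convert! (hw.const_mul (α * β)).mul (hasDerivAt_softPow α β hx) using 1
  have e1 : ∑ j, softHess α β (x t) i j * x' j =
      α * β ^ 2 * softPow α β (x t) * softWeight β (x t) i *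
        (x' i + (α - 1) * ∑ j, softWeight β (x t) j * x' j) := by
    have : x' i = ∑ j, (if i = j then 1 else 0) * x' j := by simp
    conv_rhs => rw [this]
    rw [Finset.mul_sum, ← Finset.sum_add_distrib, Finset.mul_sum]
    refine Finset.sum_congr rfl fun j _ => ?_
    unfold softHess
    ring
  have e2 : ∑ j, softGrad α β (x t) j * x' j =
      α * β * softPow α β (x t) * ∑ j, softWeight β (x t) j * x' j := by
    rw [Finset.mul_sum]
    refine Finset.sum_congr rfl fun j _ => ?_
    unfold softGrad
    ring
  rw [e1, e2]
  ring

end Deriv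

theorem measurable_softPow_linVec (α β : ℝ) (D : ι → κ → ℝ) :
    Measurable fun g => softPow α β (linVec D g) := by
  have := measurable_linVec D
  unfold softPow; fun_prop

theorem measurable_softWeight_linVec (β : ℝ) (D : ι → κ → ℝ) (i : ι) :
    Measurable fun g => softWeight β (linVec D g) i := by
  have := measurable_linVec D
  unfold softWeight; fun_prop

theorem measurable_softGrad_linVec (α β : ℝ) (D : ι → κ → ℝ) (i : ι) :
    Measurable fun g => softGrad α β (linVec D g) i := by
  have := measurable_softPow_linVec α β D
  have := measurable_softWeight_linVec β D i
  unfold softGrad; fun_prop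

theorem measurable_softHess_linVec [DecidableEq ι] (α β : ℝ) (D : ι → κ → ℝ) (i j : ι) :
    Measurable fun g => softHess α β (linVec D g) i j := by
  have := measurable_softPow_linVec α β D
  have := measurable_softWeight_linVec β D
  unfold softHess; fun_prop

section Growth

variable [Nonempty ι] {α β b : ℝ} {D : ι → κ → ℝ}

theorem softPow_linVec_le (hα : 0 ≤ α) (hβ : 0 ≤ β) (hD : ∀ i k, |D i k| ≤ b) (g : κ → ℝ) :
    softPow α β (linVec D g) ≤ Real.exp (α * Real.log (Fintype.card ι)) *
      Real.exp (α * β * b * ∑ k, |g k|) := by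
  rw [mul_assoc (α * β)]
  exact softPow_le hα hβ _ fun i => (le_abs_self _).trans (abs_linVec_le hD g i)

theorem abs_softGrad_linVec_le (hα : 0 ≤ α) (hβ : 0 ≤ β) (hD : ∀ i k, |D i k| ≤ b) (i : ι)
    (g : κ → ℝ) :
    |softGrad α β (linVec D g) i| ≤ (α * β * Real.exp (α * Real.log (Fintype.card ι))) *
      Real.exp (α * β * b * ∑ k, |g k|) := by
  rw [mul_assoc (α * β) (Real.exp _)]
  exact (abs_softGrad_le hα hβ _ i).trans
    (mul_le_mul_of_nonneg_left (softPow_linVec_le hα hβ hD g) (by positivity))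

theorem abs_softHess_linVec_le [DecidableEq ι] (hα : 0 ≤ α) (hα1 : α ≤ 1) (hβ : 0 ≤ β)
    (hD : ∀ i k, |D i k| ≤ b) (i j : ι) (g : κ → ℝ) :
    |softHess α β (linVec D g) i j| ≤
      (α * β ^ 2 * 2 * Real.exp (α * Real.log (Fintype.card ι))) *
      Real.exp (α * β * b * ∑ k, |g k|) := by
  rw [mul_assoc (α * β ^ 2 * 2)]
  exact (abs_softHess_le hα hα1 _ i j).trans
    (mul_le_mul_of_nonneg_left (softPow_linVec_le hα hβ hD g) (by positivity))

theorem integrable_softPow_linVec (hα : 0 ≤ α) (hβ : 0 ≤ β) (hD : ∀ i k, |D i k| ≤ b) :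
    Integrable (fun g => softPow α β (linVec D g)) (gaussPi κ) :=
  integrable_gaussPi_of_exp_growth (measurable_softPow_linVec α β D) _ _ fun g => by
    rw [abs_of_pos (softPow_pos _ _ _)]; exact softPow_linVec_le hα hβ hD g

theorem integrable_softHess_linVec [DecidableEq ι] (hα : 0 ≤ α) (hα1 : α ≤ 1) (hβ : 0 ≤ β)
    (hD : ∀ i k, |D i k| ≤ b) (i j : ι) :
    Integrable (fun g => softHess α β (linVec D g) i j) (gaussPi κ) :=
  integrable_gaussPi_of_exp_growth (measurable_softHess_linVec α β D i j) _ _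
    (abs_softHess_linVec_le hα hα1 hβ hD i j)

theorem integrable_coord_mul_softGrad_linVec (hα : 0 ≤ α) (hβ : 0 ≤ β)
    (hD : ∀ i k, |D i k| ≤ b) (i : ι) (k : κ) :
    Integrable (fun g => g k * softGrad α β (linVec D g) i) (gaussPi κ) :=
  integrable_coord_mul_gaussPi_of_exp_growth (measurable_softGrad_linVec α β D i) _ _
    (abs_softGrad_linVec_le hα hβ hD i) k

theorem integral_coord_mul_softGrad_linVec [DecidableEq ι] (hα : 0 ≤ α) (hα1 : α ≤ 1)
    (hβ : 0 ≤ β) (hD : ∀ i k, |D i k| ≤ b) (i : ι) (k : κ) :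
    ∫ g, g k * softGrad α β (linVec D g) i ∂(gaussPi κ) =
      ∑ j, D j k * ∫ g, softHess α β (linVec D g) i j ∂(gaussPi κ) := by
  classical
  have hhi := integrable_softHess_linVec hα hα1 hβ hD i
  rw [integral_coord_mul_gaussPi k (f := fun g => softGrad α β (linVec D g) i)
    (f' := fun g => ∑ j, softHess α β (linVec D g) i j * D j k) ?_
    (integrable_gaussPi_of_exp_growth (measurable_softGrad_linVec α β D i) _ _
      (abs_softGrad_linVec_le hα hβ hD i))
    (integrable_finsetSum _ fun j _ => (hhi j).mul_const _)
    (integrable_coord_mul_softGrad_linVec hα hβ hD i k),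
    integral_finsetSum _ fun j _ => (hhi j).mul_const _]
  · refine Finset.sum_congr rfl fun j _ => ?_
    rw [integral_mul_const, mul_comm]
  · intro g t
    refine hasDerivAt_softGrad (x := fun s => linVec D (Function.update g k s)) α β
      (fun j => ?_) i
    have : HasDerivAt (fun s => ∑ l, D j l * Function.update g k s l)
        (∑ l, D j l * (Pi.single k 1 : κ → ℝ) l) t := by
      refine HasDerivAt.fun_sum fun l _ => HasDerivAt.const_mul _ ?_
      exact hasDerivAt_pi.1 (hasDerivAt_update g k t) l
    simpa [Pi.single_apply, linVec] using this

end Growth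

/-- Differentiation of the expected smooth maximum along a bounded path of covariance roots. -/
theorem hasDerivAt_integral_softPow_linVec [Nonempty ι] [DecidableEq ι] {α β b : ℝ} (hα : 0 ≤ α)
    (hα1 : α ≤ 1) (hβ : 0 ≤ β) {A A' : ℝ → ι → κ → ℝ} (hA : ∀ θ i k, |A θ i k| ≤ b)
    (hA' : ∀ θ i k, |A' θ i k| ≤ b)
    (hd : ∀ θ i k, HasDerivAt (fun s => A s i k) (A' θ i k) θ) (hb : 0 ≤ b) (θ : ℝ) :
    HasDerivAt (fun s => ∫ g, softPow α β (linVec (A s) g) ∂(gaussPi κ))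
      (∑ i, ∑ j, (∑ k, A' θ i k * A θ j k) *
        ∫ g, softHess α β (linVec (A θ) g) i j ∂(gaussPi κ)) θ := by
  set C : ℝ := Real.exp (α * Real.log (Fintype.card ι)) with hC
  have hval : ∫ g, ∑ i, softGrad α β (linVec (A θ) g) i * linVec (A' θ) g i ∂(gaussPi κ) =
      ∑ i, ∑ j, (∑ k, A' θ i k * A θ j k) *
        ∫ g, softHess α β (linVec (A θ) g) i j ∂(gaussPi κ) := by
    have hkgi := integrable_coord_mul_softGrad_linVec hα hβ (hA θ)
    have e : ∀ g, ∑ i, softGrad α β (linVec (A θ) g) i * linVec (A' θ) g i =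
        ∑ i, ∑ k, A' θ i k * (g k * softGrad α β (linVec (A θ) g) i) := by
      intro g
      refine Finset.sum_congr rfl fun i _ => ?_
      rw [linVec, Finset.mul_sum]
      exact Finset.sum_congr rfl fun k _ => by ring
    simp only [e]
    rw [integral_finsetSum _ fun i _ => integrable_finsetSum _ fun k _ =>
      (hkgi i k).const_mul _]
    refine Finset.sum_congr rfl fun i _ => ?_
    rw [integral_finsetSum _ fun k _ => (hkgi i k).const_mul _]
    simp only [integral_const_mul, integral_coord_mul_softGrad_linVec hα hα1 hβ (hA θ),
      Finset.mul_sum, Finset.sum_mul]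
    rw [Finset.sum_comm]
    refine Finset.sum_congr rfl fun j _ => Finset.sum_congr rfl fun k _ => by ring
  rw [← hval]
  refine (hasDerivAt_integral_of_dominated_loc_of_deriv_le
    (F := fun s g => softPow α β (linVec (A s) g))
    (F' := fun s g => ∑ i, softGrad α β (linVec (A s) g) i * linVec (A' s) g i)
    (s := Set.univ)
    (bound := fun g => (Fintype.card ι * (α * β * C) * b) *
      Real.exp ((α * β * b + 1) * ∑ k, |g k|))
    Filter.univ_mem
    (Filter.Eventually.of_forall fun s =>
      (measurable_softPow_linVec α β (A s)).aestronglyMeasurable)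
    (integrable_softPow_linVec hα hβ (hA θ)) ?_ ?_
    ((integrable_exp_sum_abs_gaussPi _).const_mul _) ?_).2
  · have h1 := measurable_softGrad_linVec α β (A θ)
    have h2 := measurable_linVec (A' θ)
    exact (Finset.measurable_fun_sum _ fun i _ => (h1 i).mul (h2 i)).aestronglyMeasurable
  · refine ae_of_all _ fun g s _ => ?_
    rw [Real.norm_eq_abs]
    refine (Finset.abs_sum_le_sum_abs _ _).trans ?_
    calc _ ≤ ∑ _i : ι, ((α * β * C) * Real.exp (α * β * b * ∑ k, |g k|)) *
          (b * Real.exp (∑ k, |g k|)) := by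
          refine Finset.sum_le_sum fun i _ => ?_
          rw [abs_mul]
          refine mul_le_mul (abs_softGrad_linVec_le hα hβ (hA s) i g)
            ((abs_linVec_le (hA' s) g i).trans ?_) (abs_nonneg _) (by positivity)
          exact mul_le_mul_of_nonneg_left (sum_abs_le_exp g) hb
      _ = _ := by
          rw [Finset.sum_const, Finset.card_univ, nsmul_eq_mul, add_mul, one_mul, Real.exp_add]
          ring
  · refine ae_of_all _ fun g s _ => hasDerivAt_softPow (x := fun s => linVec (A s) g) α β
      fun i => ?_
    exact HasDerivAt.fun_sum fun k _ => (hd s i k).mul_const _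

/-- **Kahane's comparison inequality** for the smooth maximum: if two centred Gaussian vectors
`M₀ g` and `M₁ g` have the same variances and the covariances of the second do not exceed those of
the first, then the second has the larger expected smooth maximum. -/
theorem integral_softPow_le_of_covariance_le [Nonempty ι] {α β : ℝ} (hα : 0 ≤ α) (hα1 : α ≤ 1)
    (hβ : 0 ≤ β) (M₀ M₁ : ι → κ → ℝ) (hcross : ∀ i j, ∑ k, M₀ i k * M₁ j k = 0)
    (hdiag : ∀ i, ∑ k, M₁ i k * M₁ i k = ∑ k, M₀ i k * M₀ i k)
    (hoff : ∀ i j, ∑ k, M₁ i k * M₁ j k ≤ ∑ k, M₀ i k * M₀ j k) :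
    ∫ g, softPow α β (linVec M₀ g) ∂(gaussPi κ) ≤
      ∫ g, softPow α β (linVec M₁ g) ∂(gaussPi κ) := by
  classical
  let A : ℝ → ι → κ → ℝ := fun θ i k => Real.cos θ * M₀ i k + Real.sin θ * M₁ i k
  let A' : ℝ → ι → κ → ℝ := fun θ i k => -Real.sin θ * M₀ i k + Real.cos θ * M₁ i k
  set b : ℝ := ∑ i, ∑ k, (|M₀ i k| + |M₁ i k|) with hb
  have hbik : ∀ i k, |M₀ i k| + |M₁ i k| ≤ b := fun i k =>
    (Finset.single_le_sum (f := fun k => |M₀ i k| + |M₁ i k|) (fun _ _ => by positivity)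
      (Finset.mem_univ k)).trans (Finset.single_le_sum
        (f := fun i => ∑ k, (|M₀ i k| + |M₁ i k|))
        (fun _ _ => Finset.sum_nonneg fun _ _ => by positivity) (Finset.mem_univ i))
  have hb0 : 0 ≤ b := Finset.sum_nonneg fun _ _ => Finset.sum_nonneg fun _ _ => by positivity
  have hcomb : ∀ (c s u v : ℝ), |c| ≤ 1 → |s| ≤ 1 → |c * u + s * v| ≤ |u| + |v| := by
    intro c s u v hc hs
    refine (abs_add_le _ _).trans (add_le_add ?_ ?_) <;> rw [abs_mul]
    · exact mul_le_of_le_one_left (abs_nonneg _) hc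
    · exact mul_le_of_le_one_left (abs_nonneg _) hs
  have hderiv := hasDerivAt_integral_softPow_linVec (κ := κ) (b := b) hα hα1 hβ (A := A) (A' := A')
    (fun θ i k => (hcomb _ _ _ _ (Real.abs_cos_le_one θ) (Real.abs_sin_le_one θ)).trans (hbik i k))
    (fun θ i k => (hcomb _ _ _ _ (by rw [abs_neg]; exact Real.abs_sin_le_one θ)
      (Real.abs_cos_le_one θ)).trans (hbik i k))
    (fun θ i k => ((Real.hasDerivAt_cos θ).mul_const _).add ((Real.hasDerivAt_sin θ).mul_const _))
    hb0
  have hcov : ∀ θ i j, ∑ k, A' θ i k * A θ j k =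
      Real.sin θ * Real.cos θ * (∑ k, M₁ i k * M₁ j k - ∑ k, M₀ i k * M₀ j k) := by
    intro θ i j
    have hx : ∑ k, A' θ i k * A θ j k =
        Real.sin θ * Real.cos θ * (∑ k, M₁ i k * M₁ j k - ∑ k, M₀ i k * M₀ j k)
        - Real.sin θ ^ 2 * ∑ k, M₀ i k * M₁ j k + Real.cos θ ^ 2 * ∑ k, M₀ j k * M₁ i k := by
      simp only [Finset.mul_sum, ← Finset.sum_sub_distrib, ← Finset.sum_add_distrib]
      exact Finset.sum_congr rfl fun k _ => by simp only [A, A']; ring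
    rw [hx, hcross, hcross]
    ring
  have hmono : MonotoneOn (fun s => ∫ g, softPow α β (linVec (A s) g) ∂(gaussPi κ))
      (Set.Icc 0 (Real.pi / 2)) := by
    refine monotoneOn_of_deriv_nonneg (convex_Icc _ _)
      (fun s _ => (hderiv s).continuousAt.continuousWithinAt)
      (fun s _ => (hderiv s).differentiableAt.differentiableWithinAt) fun s hs => ?_
    rw [interior_Icc] at hs
    rw [(hderiv s).deriv]
    have hsin : 0 ≤ Real.sin s :=
      Real.sin_nonneg_of_nonneg_of_le_pi hs.1.le (by linarith [hs.2, Real.pi_pos])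
    have hcos : 0 ≤ Real.cos s :=
      Real.cos_nonneg_of_neg_pi_div_two_le_of_le (by linarith [hs.1, Real.pi_pos]) hs.2.le
    refine Finset.sum_nonneg fun i _ => Finset.sum_nonneg fun j _ => ?_
    rw [hcov]
    by_cases hij : i = j
    · subst hij
      rw [hdiag, sub_self, mul_zero, zero_mul]
    · refine mul_nonneg_of_nonpos_of_nonpos
        (mul_nonpos_of_nonneg_of_nonpos (mul_nonneg hsin hcos) (sub_nonpos.2 (hoff i j)))
        (integral_nonpos fun g => softHess_nonpos_of_ne hα hα1 _ hij)
  have hpi : (0 : ℝ) ≤ Real.pi / 2 := by positivity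
  have h := hmono (Set.left_mem_Icc.2 hpi) (Set.right_mem_Icc.2 hpi) hpi
  have h0 : A 0 = M₀ := by funext i k; simp [A]
  have h1 : A (Real.pi / 2) = M₁ := by funext i k; simp [A]
  simpa only [h0, h1] using h

end Comparison

theorem measurePreserving_gaussPi_sum (κ₁ κ₂ : Type*) [Fintype κ₁] [Fintype κ₂] :
    MeasurePreserving (fun g : κ₁ ⊕ κ₂ → ℝ => ((fun i => g (Sum.inl i)), fun i => g (Sum.inr i)))
      (gaussPi (κ₁ ⊕ κ₂)) ((gaussPi κ₁).prod (gaussPi κ₂)) :=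
  measurePreserving_sumPiEquivProdPi (fun _ : κ₁ ⊕ κ₂ => gaussianReal 0 1)

theorem integral_gaussPi_sum {κ₁ κ₂ : Type*} [Fintype κ₁] [Fintype κ₂]
    {f : (κ₁ → ℝ) → ℝ} {h : (κ₂ → ℝ) → ℝ} (hf : Measurable f) (hh : Measurable h) :
    ∫ g : κ₁ ⊕ κ₂ → ℝ, f (fun i => g (Sum.inl i)) * h (fun i => g (Sum.inr i))
      ∂(gaussPi (κ₁ ⊕ κ₂)) = (∫ x, f x ∂(gaussPi κ₁)) * ∫ y, h y ∂(gaussPi κ₂) := by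
  rw [← integral_prod_mul f h, ← (measurePreserving_gaussPi_sum κ₁ κ₂).map_eq,
    integral_map (measurePreserving_gaussPi_sum κ₁ κ₂).measurable.aemeasurable]
  exact ((hf.comp measurable_fst).mul (hh.comp measurable_snd)).aestronglyMeasurable

theorem integral_exp_mul_coord_gaussPi {κ : Type*} [Fintype κ] (k : κ) (t : ℝ) :
    ∫ g, Real.exp (t * g k) ∂(gaussPi κ) = Real.exp (t ^ 2 / 2) := by
  have h := mgf_gaussianReal (p := gaussPi κ) (X := fun g => g k)
    (measurePreserving_eval (fun _ : κ => gaussianReal 0 1) k).map_eq t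
  simpa [mgf] using h

section Bilinear

variable {a b : Type*} [Fintype a] [Fintype b]

/-- The bilinear form of the matrix with entries `G (p, q)`. -/
noncomputable def bilinPair (G : a × b → ℝ) (v : a → ℝ) (u : b → ℝ) : ℝ :=
  ∑ k : a × b, (v k.1 * u k.2) * G k

/-- The maximum of finitely many values of the bilinear form of `G`. -/
noncomputable def bilinMax {ι : Type*} [Fintype ι] [Nonempty ι] (v : ι → a → ℝ) (u : ι → b → ℝ)
    (G : a × b → ℝ) : ℝ :=
  Finset.univ.sup' Finset.univ_nonempty fun i => bilinPair G (v i) (u i)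

theorem measurable_bilinMax {ι : Type*} [Fintype ι] [Nonempty ι] (v : ι → a → ℝ)
    (u : ι → b → ℝ) : Measurable (bilinMax v u) := by
  have : ∀ i, Measurable fun G : a × b → ℝ => bilinPair G (v i) (u i) := fun i => by
    unfold bilinPair; fun_prop
  have h := Finset.measurable_sup' (s := (Finset.univ : Finset ι)) Finset.univ_nonempty
    (f := fun i (G : a × b → ℝ) => bilinPair G (v i) (u i)) fun i _ => this i
  convert h using 1
  ext G
  simp [bilinMax]

theorem sum_mul_le_smoothNorm {κ : Type*} [Fintype κ] {u : κ → ℝ} (hu : ∑ k, u k ^ 2 = 1)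
    (g : κ → ℝ) : ∑ k, u k * g k ≤ smoothNorm 0 g := by
  refine Real.le_sqrt_of_sq_le ?_
  have := Finset.sum_mul_sq_le_sq_mul_sq Finset.univ u g
  rw [hu, one_mul] at this
  rwa [zero_add]

theorem sum_mul_le_one {κ : Type*} [Fintype κ] {u w : κ → ℝ} (hu : ∑ k, u k ^ 2 = 1)
    (hw : ∑ k, w k ^ 2 = 1) : ∑ k, u k * w k ≤ 1 := by
  have := sum_mul_le_smoothNorm hu w
  rwa [smoothNorm, hw, zero_add, Real.sqrt_one] at this

theorem integral_exp_bilinMax_le_aux {ι : Type*} [Fintype ι] [Nonempty ι] {v : ι → a → ℝ}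
    {u : ι → b → ℝ} (hv : ∀ i, ∑ p, v i p ^ 2 = 1) (hu : ∀ i, ∑ p, u i p ^ 2 = 1)
    {t : ℝ} (ht : 0 ≤ t) {α : ℝ} (hα : 0 < α) (hα1 : α ≤ 1) :
    (∫ G, Real.exp (t * bilinMax v u G) ∂(gaussPi (a × b))) * Real.exp (t ^ 2 / 2) ≤
      Real.exp (α * Real.log (Fintype.card ι)) *
      (Real.exp (t * √(Fintype.card b) + t ^ 2 / 2) *
        Real.exp (t * √(Fintype.card a) + t ^ 2 / 2)) := by
  set β : ℝ := t / α with hβ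
  have hβ0 : 0 ≤ β := div_nonneg ht hα.le
  have hαβ : α * β = t := by rw [hβ]; field_simp
  let M₀ : ι → ((a × b) ⊕ Unit) ⊕ (b ⊕ a) → ℝ := fun i =>
    Sum.elim (Sum.elim (fun k => v i k.1 * u i k.2) fun _ => 1) 0
  let M₁ : ι → ((a × b) ⊕ Unit) ⊕ (b ⊕ a) → ℝ := fun i => Sum.elim 0 (Sum.elim (u i) (v i))
  have h00 : ∀ i j, ∑ k, M₀ i k * M₀ j k =
      (∑ p, v i p * v j p) * (∑ p, u i p * u j p) + 1 := by
    intro i j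
    simp only [M₀, Fintype.sum_sum_type, Sum.elim_inl, Sum.elim_inr, Pi.zero_apply, mul_zero,
      Finset.sum_const_zero, add_zero, Finset.univ_unique, Finset.sum_singleton, mul_one,
      Fintype.sum_prod_type, Finset.sum_mul_sum]
    congr 1
    exact Finset.sum_congr rfl fun p _ => Finset.sum_congr rfl fun q _ => by ring
  have h11 : ∀ i j, ∑ k, M₁ i k * M₁ j k = (∑ p, u i p * u j p) + ∑ p, v i p * v j p := by
    intro i j
    simp [M₁, Fintype.sum_sum_type]
  have hcmp := integral_softPow_le_of_covariance_le hα.le hα1 hβ0 M₀ M₁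
    (by intro i j; simp [M₀, M₁, Fintype.sum_sum_type])
    (by
      intro i
      rw [h00, h11]
      simp only [← sq, hu, hv]
      norm_num)
    (by
      intro i j
      rw [h00, h11]
      nlinarith [sum_mul_le_one (hu i) (hu j), sum_mul_le_one (hv i) (hv j)])
  have hbd : ∀ (D : ι → ((a × b) ⊕ Unit) ⊕ (b ⊕ a) → ℝ), ∃ c, ∀ i k, |D i k| ≤ c := by
    intro D
    refine ⟨∑ i, ∑ k, |D i k|, fun i k => ?_⟩
    exact (Finset.single_le_sum (f := fun k => |D i k|) (fun _ _ => abs_nonneg _)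
      (Finset.mem_univ k)).trans (Finset.single_le_sum (f := fun i => ∑ k, |D i k|)
        (fun _ _ => Finset.sum_nonneg fun _ _ => abs_nonneg _) (Finset.mem_univ i))
  have hmax := measurable_bilinMax v u
  have hsa := measurable_smoothNorm (κ := a) 0
  have hsb := measurable_smoothNorm (κ := b) 0
  have hleft : (∫ G, Real.exp (t * bilinMax v u G) ∂(gaussPi (a × b))) * Real.exp (t ^ 2 / 2) ≤
      ∫ g, softPow α β (linVec M₀ g) ∂(gaussPi (((a × b) ⊕ Unit) ⊕ (b ⊕ a))) := by
    rw [← integral_exp_mul_coord_gaussPi (κ := Unit) () t,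
      ← integral_gaussPi_sum (f := fun G => Real.exp (t * bilinMax v u G))
        (h := fun g => Real.exp (t * g ())) (by fun_prop) (by fun_prop)]
    have h1 := integral_gaussPi_sum (κ₂ := b ⊕ a) (f := fun g : (a × b) ⊕ Unit → ℝ =>
      Real.exp (t * bilinMax v u (fun i => g (Sum.inl i))) * Real.exp (t * g (Sum.inr ())))
      (h := fun _ => 1) (by fun_prop) measurable_const
    simp only [integral_const, probReal_univ, smul_eq_mul, mul_one] at h1
    rw [← h1]
    obtain ⟨c, hc⟩ := hbd M₀
    refine integral_mono_of_nonneg (ae_of_all _ fun g => by positivity)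
      (integrable_softPow_linVec hα.le hβ0 hc) (ae_of_all _ fun g => ?_)
    simp only
    rw [← Real.exp_add, ← mul_add]
    obtain ⟨i, -, hi⟩ := Finset.exists_mem_eq_sup' (s := (Finset.univ : Finset ι))
      Finset.univ_nonempty
      fun i => bilinPair (fun k => g (Sum.inl (Sum.inl k))) (v i) (u i)
    refine le_trans (le_of_eq ?_) (exp_le_softPow hα.le _ i)
    rw [hαβ, bilinMax, hi]
    congr 2
    simp [linVec, M₀, Fintype.sum_sum_type, bilinPair]
  have hright : ∫ g, softPow α β (linVec M₁ g) ∂(gaussPi (((a × b) ⊕ Unit) ⊕ (b ⊕ a))) ≤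
      Real.exp (α * Real.log (Fintype.card ι)) *
      ((∫ g, Real.exp (t * smoothNorm 0 g) ∂(gaussPi b)) *
        ∫ g, Real.exp (t * smoothNorm 0 g) ∂(gaussPi a)) := by
    rw [← integral_gaussPi_sum (f := fun g : b → ℝ => Real.exp (t * smoothNorm 0 g))
        (h := fun g : a → ℝ => Real.exp (t * smoothNorm 0 g)) (by fun_prop) (by fun_prop)]
    have h1 := integral_gaussPi_sum (κ₁ := (a × b) ⊕ Unit) (κ₂ := b ⊕ a)
      (h := fun g : b ⊕ a → ℝ =>
      Real.exp (t * smoothNorm 0 (fun i => g (Sum.inl i))) *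
        Real.exp (t * smoothNorm 0 (fun i => g (Sum.inr i))))
      (f := fun _ => 1) measurable_const (by fun_prop)
    simp only [integral_const, probReal_univ, smul_eq_mul, one_mul, mul_one] at h1
    rw [← h1, ← integral_const_mul]
    refine integral_mono_of_nonneg (ae_of_all _ fun g => (softPow_pos _ _ _).le) ?_
      (ae_of_all _ fun g => ?_)
    · refine Integrable.const_mul ?_ _
      have i1 := (integrable_exp_mul_smoothNorm (κ := b) le_rfl t).mul_prod
        (integrable_exp_mul_smoothNorm (κ := a) le_rfl t)
      have i2 := (measurePreserving_gaussPi_sum b a).integrable_comp_of_integrable i1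
      have i3 := i2.comp_snd (gaussPi ((a × b) ⊕ Unit))
      exact (measurePreserving_gaussPi_sum ((a × b) ⊕ Unit) (b ⊕ a)).integrable_comp_of_integrable
        i3
    · simp only
      rw [← Real.exp_add, ← mul_add, ← hαβ]
      refine softPow_le hα.le hβ0 _ fun i => ?_
      have e : linVec M₁ g i = ∑ p, u i p * g (Sum.inr (Sum.inl p)) +
          ∑ p, v i p * g (Sum.inr (Sum.inr p)) := by
        simp [linVec, M₁, Fintype.sum_sum_type]
      rw [e]
      exact add_le_add (sum_mul_le_smoothNorm (hu i) _) (sum_mul_le_smoothNorm (hv i) _)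
  refine (hleft.trans (hcmp.trans hright)).trans (mul_le_mul_of_nonneg_left ?_ (by positivity))
  exact mul_le_mul (integral_exp_mul_norm_gaussPi_le ht) (integral_exp_mul_norm_gaussPi_le ht)
    (integral_nonneg fun _ => by positivity) (by positivity)

theorem integral_exp_bilinMax_le {ι : Type*} [Fintype ι] [Nonempty ι] {v : ι → a → ℝ}
    {u : ι → b → ℝ} (hv : ∀ i, ∑ p, v i p ^ 2 = 1) (hu : ∀ i, ∑ p, u i p ^ 2 = 1)
    {t : ℝ} (ht : 0 ≤ t) :
    ∫ G, Real.exp (t * bilinMax v u G) ∂(gaussPi (a × b)) ≤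
      Real.exp (t * (√(Fintype.card b) + √(Fintype.card a)) + t ^ 2 / 2) := by
  set R := Real.exp (t * √(Fintype.card b) + t ^ 2 / 2) *
        Real.exp (t * √(Fintype.card a) + t ^ 2 / 2) with hR
  have hlim : Filter.Tendsto (fun α : ℝ => Real.exp (α * Real.log (Fintype.card ι)) * R)
      (nhdsWithin 0 (Set.Ioi 0)) (nhds (Real.exp (0 * Real.log (Fintype.card ι)) * R)) := by
    refine Filter.Tendsto.mono_left (Continuous.tendsto ?_ 0) nhdsWithin_le_nhds
    fun_prop
  have h := ge_of_tendsto (b := (∫ G, Real.exp (t * bilinMax v u G) ∂(gaussPi (a × b))) *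
    Real.exp (t ^ 2 / 2)) hlim (by
      filter_upwards [Ioc_mem_nhdsGT (zero_lt_one' ℝ)] with α hα
      exact integral_exp_bilinMax_le_aux hv hu ht hα.1 hα.2)
  rw [zero_mul, Real.exp_zero, one_mul, hR, ← Real.exp_add] at h
  rw [← le_div_iff₀ (Real.exp_pos _), ← Real.exp_sub] at h
  refine h.trans (le_of_eq ?_)
  congr 1
  ring

end Bilinear

section SpecNorm

theorem toEuclideanLin_of_apply {a b : Type*} [Fintype b] [DecidableEq b] (G : a × b → ℝ) (u : EuclideanSpace ℝ b) (p : a) :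
    Matrix.toEuclideanLin (Matrix.of fun i j => G (i, j)) u p = ∑ q, G (p, q) * u q := by
  rw [Matrix.toLpLin_apply]
  rfl

variable {a b : Type*} [Fintype a] [Fintype b]

/-- The spectral norm of the matrix with entries `G (p, q)`. -/
noncomputable def specNorm [DecidableEq b] (G : a × b → ℝ) : ℝ :=
  ‖(Matrix.toEuclideanLin (Matrix.of fun i j => G (i, j))).toContinuousLinearMap‖

variable [DecidableEq b]

theorem specNorm_nonneg (G : a × b → ℝ) : 0 ≤ specNorm G := norm_nonneg _

theorem inner_toEuclideanLin_of (G : a × b → ℝ) (v : EuclideanSpace ℝ a)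
    (u : EuclideanSpace ℝ b) :
    inner ℝ v (Matrix.toEuclideanLin (Matrix.of fun i j => G (i, j)) u) = bilinPair G v u := by
  rw [PiLp.inner_apply, bilinPair, Fintype.sum_prod_type]
  refine Finset.sum_congr rfl fun p _ => ?_
  rw [toEuclideanLin_of_apply]
  simp only [RCLike.inner_apply, conj_trivial, Finset.sum_mul]
  exact Finset.sum_congr rfl fun q _ => by ring

theorem norm_toEuclideanLin_of_le (G : a × b → ℝ) (u : EuclideanSpace ℝ b) :
    ‖Matrix.toEuclideanLin (Matrix.of fun i j => G (i, j)) u‖ ≤ specNorm G * ‖u‖ :=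
  (Matrix.toEuclideanLin (Matrix.of fun i j => G (i, j))).toContinuousLinearMap.le_opNorm u

theorem bilinPair_le_specNorm (G : a × b → ℝ) (v : EuclideanSpace ℝ a)
    (u : EuclideanSpace ℝ b) : bilinPair G v u ≤ specNorm G * ‖v‖ * ‖u‖ := by
  rw [← inner_toEuclideanLin_of]
  refine (real_inner_le_norm _ _).trans ?_
  calc _ ≤ ‖v‖ * (specNorm G * ‖u‖) :=
        mul_le_mul_of_nonneg_left (norm_toEuclideanLin_of_le G u) (norm_nonneg _)
    _ = _ := by ring

theorem specNorm_le_of_bilinPair_le {G : a × b → ℝ} {M : ℝ} (hM : 0 ≤ M)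
    (h : ∀ (v : EuclideanSpace ℝ a) (u : EuclideanSpace ℝ b), ‖v‖ = 1 → ‖u‖ = 1 →
      bilinPair G v u ≤ M) : specNorm G ≤ M := by
  refine ContinuousLinearMap.opNorm_le_of_unit_norm hM fun u hu => ?_
  set w := (Matrix.toEuclideanLin (Matrix.of fun i j => G (i, j))).toContinuousLinearMap u with hw
  by_cases h0 : w = 0
  · rw [h0, norm_zero]; exact hM
  · have hn : ‖w‖ ≠ 0 := norm_ne_zero_iff.2 h0
    have h1 := h (‖w‖⁻¹ • w) u (by rw [norm_smul, norm_inv, norm_norm, inv_mul_cancel₀ hn]) hu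
    rw [← inner_toEuclideanLin_of] at h1
    change inner ℝ (‖w‖⁻¹ • w) w ≤ M at h1
    rw [real_inner_smul_left, real_inner_self_eq_norm_sq, sq, ← mul_assoc, inv_mul_cancel₀ hn,
      one_mul] at h1
    exact h1

theorem specNorm_le_smoothNorm (G : a × b → ℝ) : specNorm G ≤ smoothNorm 0 G := by
  refine specNorm_le_of_bilinPair_le (Real.sqrt_nonneg _) fun v u hv hu => ?_
  refine sum_mul_le_smoothNorm (u := fun k : a × b => v k.1 * u k.2) ?_ G
  rw [Fintype.sum_prod_type]
  simp only [mul_pow, ← Finset.mul_sum]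
  rw [← EuclideanSpace.real_norm_sq_eq, hu, ← Finset.sum_mul, ← EuclideanSpace.real_norm_sq_eq, hv]
  norm_num

theorem exists_seq_isLUB_specNorm [Nonempty a] [Nonempty b] :
    ∃ (v : ℕ → a → ℝ) (u : ℕ → b → ℝ), (∀ i, ∑ p, v i p ^ 2 = 1) ∧ (∀ i, ∑ p, u i p ^ 2 = 1) ∧
      ∀ G : a × b → ℝ, IsLUB (Set.range fun i => bilinPair G (v i) (u i)) (specNorm G) := by
  let S := Metric.sphere (0 : EuclideanSpace ℝ a) 1 × Metric.sphere (0 : EuclideanSpace ℝ b) 1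
  have : Nonempty (Metric.sphere (0 : EuclideanSpace ℝ a) 1) :=
    (NormedSpace.sphere_nonempty.2 zero_le_one).to_subtype
  have : Nonempty (Metric.sphere (0 : EuclideanSpace ℝ b) 1) :=
    (NormedSpace.sphere_nonempty.2 zero_le_one).to_subtype
  let s : ℕ → S := TopologicalSpace.denseSeq S
  refine ⟨fun i => (s i).1.1, fun i => (s i).2.1, fun i => ?_, fun i => ?_, fun G => ⟨?_, ?_⟩⟩
  · rw [← EuclideanSpace.real_norm_sq_eq, norm_eq_of_mem_sphere]; norm_num
  · rw [← EuclideanSpace.real_norm_sq_eq, norm_eq_of_mem_sphere]; norm_num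
  · rintro _ ⟨i, rfl⟩
    refine (bilinPair_le_specNorm G _ _).trans (le_of_eq ?_)
    rw [norm_eq_of_mem_sphere, norm_eq_of_mem_sphere, mul_one, mul_one]
  · intro M hM
    have hall : ∀ z : S, bilinPair G z.1.1 z.2.1 ≤ M := by
      have hc : Continuous fun z : S => bilinPair G z.1.1 z.2.1 := by
        have h : Continuous fun z : EuclideanSpace ℝ a × EuclideanSpace ℝ b =>
            bilinPair G z.1 z.2 := by
          unfold bilinPair; fun_prop
        exact h.comp ((continuous_subtype_val.comp continuous_fst).prodMk
          (continuous_subtype_val.comp continuous_snd))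
      have hcl : IsClosed {z : S | bilinPair G z.1.1 z.2.1 ≤ M} := isClosed_le hc continuous_const
      intro z
      have : z ∈ closure (Set.range s) := TopologicalSpace.denseRange_denseSeq S z
      refine hcl.closure_subset_iff.2 ?_ this
      rintro _ ⟨i, rfl⟩
      exact hM ⟨i, rfl⟩
    have hall' : ∀ (v : EuclideanSpace ℝ a) (u : EuclideanSpace ℝ b), ‖v‖ = 1 → ‖u‖ = 1 →
        bilinPair G v u ≤ M := fun v u hv hu =>
      hall (⟨v, by simpa using hv⟩, ⟨u, by simpa using hu⟩)
    refine specNorm_le_of_bilinPair_le ?_ hall'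
    obtain ⟨⟨v, hv⟩⟩ := ‹Nonempty (Metric.sphere (0 : EuclideanSpace ℝ a) 1)›
    obtain ⟨⟨u, hu⟩⟩ := ‹Nonempty (Metric.sphere (0 : EuclideanSpace ℝ b) 1)›
    rw [mem_sphere_zero_iff_norm] at hv hu
    have h1 := hall' v u hv hu
    have h2 := hall' (-v) u (by rwa [norm_neg]) hu
    rw [← inner_toEuclideanLin_of] at h1 h2
    rw [inner_neg_left] at h2
    linarith

theorem measurable_specNorm : Measurable (specNorm (a := a) (b := b)) := by
  let T : (a × b → ℝ) →ₗ[ℝ] (EuclideanSpace ℝ b →L[ℝ] EuclideanSpace ℝ a) :=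
    { toFun := fun G =>
        (Matrix.toEuclideanLin (Matrix.of fun i j => G (i, j))).toContinuousLinearMap
      map_add' := fun G H => by
        rw [← map_add, ← map_add]; rfl
      map_smul' := fun c G => by
        rw [RingHom.id_apply, ← map_smul, ← map_smul]; rfl }
  exact (T.continuous_of_finiteDimensional.norm).measurable

theorem integrable_exp_specNorm {t : ℝ} (ht : 0 ≤ t) :
    Integrable (fun G => Real.exp (t * specNorm G)) (gaussPi (a × b)) := by
  refine (integrable_exp_mul_smoothNorm le_rfl t).mono'
    (measurable_specNorm.const_mul t).exp.aestronglyMeasurable (ae_of_all _ fun G => ?_)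
  rw [Real.norm_eq_abs, Real.abs_exp]
  exact Real.exp_le_exp.2 (mul_le_mul_of_nonneg_left (specNorm_le_smoothNorm G) ht)

theorem specNorm_eq_zero_of_isEmpty [IsEmpty a] (G : a × b → ℝ) : specNorm G = 0 :=
  le_antisymm (specNorm_le_of_bilinPair_le le_rfl fun v u _ _ => by simp [bilinPair])
    (specNorm_nonneg G)

/-- `𝔼 exp (t ‖G‖) ≤ exp (t (√n + √q) + t² / 2)` for a `q × n` standard Gaussian matrix `G`. -/
theorem integral_exp_specNorm_le [Nonempty b] {t : ℝ} (ht : 0 ≤ t) :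
    ∫ G, Real.exp (t * specNorm G) ∂(gaussPi (a × b)) ≤
      Real.exp (t * (√(Fintype.card b) + √(Fintype.card a)) + t ^ 2 / 2) := by
  rcases isEmpty_or_nonempty a with ha | ha
  · simp only [specNorm_eq_zero_of_isEmpty, mul_zero, Real.exp_zero, integral_const, probReal_univ,
      smul_eq_mul, mul_one]
    exact Real.one_le_exp (by positivity)
  · obtain ⟨v, u, hv, hu, hG⟩ := exists_seq_isLUB_specNorm (a := a) (b := b)
    let F : ℕ → (a × b → ℝ) → ℝ := fun N =>
      bilinMax (ι := Fin (N + 1)) (fun i => v i) (fun i => u i)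
    have hFle : ∀ N G, F N G ≤ specNorm G := fun N G =>
      Finset.sup'_le _ _ fun i _ => (hG G).1 ⟨i, rfl⟩
    have hlim : ∀ G, Filter.Tendsto (fun N => F N G) Filter.atTop (nhds (specNorm G)) := by
      intro G
      refine tendsto_atTop_isLUB (fun N N' h => ?_) ⟨?_, ?_⟩
      · refine Finset.sup'_le _ _ fun i _ => ?_
        exact Finset.le_sup' (fun j : Fin (N' + 1) => bilinPair G (v j) (u j))
          (Finset.mem_univ (Fin.castLE (by lia) i))
      · rintro _ ⟨N, rfl⟩
        exact hFle N G
      · intro M hM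
        refine (hG G).2 ?_
        rintro _ ⟨i, rfl⟩
        refine le_trans ?_ (hM ⟨i, rfl⟩)
        exact Finset.le_sup' (fun j : Fin (i + 1) => bilinPair G (v j) (u j))
          (Finset.mem_univ (Fin.last i))
    have ht' := tendsto_integral_of_dominated_convergence (μ := gaussPi (a × b))
      (F := fun N G => Real.exp (t * F N G)) (f := fun G => Real.exp (t * specNorm G))
      (fun G => Real.exp (t * specNorm G))
      (fun N => ((measurable_bilinMax _ _).const_mul t).exp.aestronglyMeasurable)
      (integrable_exp_specNorm ht)
      (fun N => ae_of_all _ fun G => by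
        rw [Real.norm_eq_abs, Real.abs_exp]
        exact Real.exp_le_exp.2 (mul_le_mul_of_nonneg_left (hFle N G) ht))
      (ae_of_all _ fun G => ((hlim G).const_mul t).rexp)
    exact le_of_tendsto' ht' fun N => integral_exp_bilinMax_le (ι := Fin (N + 1))
      (v := fun i => v i) (u := fun i => u i) (fun i => hv i) (fun i => hu i) ht

end SpecNorm

theorem exp_neg_one_le : Real.exp (-1) ≤ 0.368 := by
  rw [Real.exp_neg, inv_le_comm₀ (Real.exp_pos _) (by norm_num)]
  exact le_trans (by norm_num) Real.exp_one_gt_d9.le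

theorem exp_neg_half_le : Real.exp (-(1 / 2)) ≤ 0.61 := by
  have h : Real.exp (-(1 / 2)) ^ 2 = Real.exp (-1) := by rw [← Real.exp_nat_mul]; norm_num
  refine le_of_sq_le_sq ?_ (by norm_num)
  rw [h]
  exact exp_neg_one_le.trans (by norm_num)

theorem mul_add_sq_le_exp {A l y : ℝ} (hA : 0 ≤ A) (hl : 0 < l) (hy : 0 ≤ y) :
    A * y + y ^ 2 ≤ (A * Real.exp (-1) / l + 4 * Real.exp (-1) ^ 2 / l ^ 2) * Real.exp (l * y) := by
  have h1 : y ≤ Real.exp (-1) / l * Real.exp (l * y) := by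
    rw [div_mul_eq_mul_div, le_div_iff₀ hl, ← Real.exp_add]
    linarith [Real.add_one_le_exp (-1 + l * y)]
  have h2 : y ^ 2 ≤ 4 * Real.exp (-1) ^ 2 / l ^ 2 * Real.exp (l * y) := by
    have h3 : y ≤ 2 * Real.exp (-1) / l * Real.exp (l * y / 2) := by
      rw [div_mul_eq_mul_div, le_div_iff₀ hl, mul_assoc, ← Real.exp_add]
      linarith [Real.add_one_le_exp (-1 + l * y / 2)]
    have h4 : Real.exp (l * y / 2) ^ 2 = Real.exp (l * y) := by
      rw [← Real.exp_nat_mul]; congr 1; push_cast; ring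
    calc y ^ 2 ≤ (2 * Real.exp (-1) / l * Real.exp (l * y / 2)) ^ 2 := pow_le_pow_left₀ hy h3 2
      _ = _ := by rw [mul_pow, h4]; ring
  calc A * y + y ^ 2 ≤ A * (Real.exp (-1) / l * Real.exp (l * y)) +
        4 * Real.exp (-1) ^ 2 / l ^ 2 * Real.exp (l * y) := by gcongr
    _ = _ := by ring

theorem sq_sub_sq_le_exp {A l d : ℝ} (hA : 0 ≤ A) (hl : 0 < l) (hd : 0 ≤ d) :
    max 0 (d ^ 2 - A ^ 2) ≤ (2 * A * Real.exp (-1) / l + 4 * Real.exp (-1) ^ 2 / l ^ 2) *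
      Real.exp (-(l * A)) * Real.exp (l * d) := by
  rw [mul_assoc, ← Real.exp_add]
  refine max_le (by positivity) ?_
  rcases le_total d A with h | h
  · exact le_trans (by nlinarith) (by positivity : (0 : ℝ) ≤ _)
  · have := mul_add_sq_le_exp (A := 2 * A) (y := d - A) (by positivity) hl (by linarith)
    have e : -(l * A) + l * d = l * (d - A) := by ring
    rw [e]
    refine le_trans (le_of_eq (by ring)) this

section SpecNormMoments

variable {a b : Type*} [Fintype a] [Fintype b] [DecidableEq b]

/-- Excess second moment of the spectral norm over the square of a level `A`. -/
theorem integral_excess_specNorm_le_of_exp [Nonempty b] {A l : ℝ} (hA : 0 ≤ A) (hl : 0 < l) :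
    ∫ G, max 0 (specNorm G ^ 2 - A ^ 2) ∂(gaussPi (a × b)) ≤
      (2 * A * Real.exp (-1) / l + 4 * Real.exp (-1) ^ 2 / l ^ 2) *
        Real.exp (-(l * A) + (l * (√(Fintype.card b) + √(Fintype.card a)) + l ^ 2 / 2)) := by
  rw [Real.exp_add, ← mul_assoc]
  refine le_trans ?_ (mul_le_mul_of_nonneg_left (integral_exp_specNorm_le (a := a) (b := b) hl.le)
    (by positivity))
  rw [← integral_const_mul]
  exact integral_mono_of_nonneg (ae_of_all _ fun _ => le_max_left _ _)
    ((integrable_exp_specNorm hl.le).const_mul _)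
    (ae_of_all _ fun G => sq_sub_sq_le_exp hA hl (specNorm_nonneg G))

theorem integral_excess_specNorm_le [Nonempty b] {ξ : ℝ} (hξ : 0 < ξ) :
    ∫ G, max 0 (specNorm G ^ 2 -
        ((1 + ξ) * (√(Fintype.card b) + √(Fintype.card a))) ^ 2) ∂(gaussPi (a × b)) ≤
      2 * (1 + ξ⁻¹) * Real.exp (-(ξ ^ 2 * (Fintype.card b + Fintype.card a) / 2)) := by
  set K : ℝ := √(Fintype.card b) + √(Fintype.card a) with hK
  have hK1 : 1 ≤ K := by
    have : (1 : ℝ) ≤ √(Fintype.card b) :=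
      Real.one_le_sqrt.2 (by exact_mod_cast Fintype.card_pos (α := b))
    linarith [Real.sqrt_nonneg (Fintype.card a : ℝ)]
  have hKsq : (Fintype.card b : ℝ) + Fintype.card a ≤ K ^ 2 := by
    rw [hK, add_sq, Real.sq_sqrt (by positivity), Real.sq_sqrt (by positivity)]
    have : 0 ≤ 2 * √(Fintype.card b : ℝ) * √(Fintype.card a) := by positivity
    linarith
  have hfin : Real.exp (-(ξ ^ 2 * K ^ 2 / 2)) ≤
      Real.exp (-(ξ ^ 2 * (Fintype.card b + Fintype.card a) / 2)) := by
    refine Real.exp_le_exp.2 ?_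
    have := mul_le_mul_of_nonneg_left hKsq (sq_nonneg ξ)
    linarith
  have hA : 0 ≤ (1 + ξ) * K := by positivity
  have hi : 0 < ξ⁻¹ := inv_pos.2 hξ
  have he0 := Real.exp_pos (-1)
  have he1 := exp_neg_one_le
  refine le_trans ?_ (mul_le_mul_of_nonneg_left hfin (by positivity))
  rcases le_or_gt 1 (ξ * K) with h | h
  · refine (integral_excess_specNorm_le_of_exp hA (by positivity : 0 < ξ * K)).trans ?_
    have e : -(ξ * K * ((1 + ξ) * K)) + (ξ * K * K + (ξ * K) ^ 2 / 2) = -(ξ ^ 2 * K ^ 2 / 2) := by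
      ring
    rw [← hK, e]
    refine mul_le_mul_of_nonneg_right ?_ (Real.exp_pos _).le
    have e2 : 2 * ((1 + ξ) * K) * Real.exp (-1) / (ξ * K) = 2 * (1 + ξ⁻¹) * Real.exp (-1) := by
      field_simp
      ring
    have e3 : 4 * Real.exp (-1) ^ 2 / (ξ * K) ^ 2 ≤ 4 * Real.exp (-1) ^ 2 :=
      div_le_self (by positivity) (one_le_pow₀ h)
    rw [e2]
    nlinarith
  · refine (integral_excess_specNorm_le_of_exp hA one_pos).trans ?_
    have e : Real.exp (-(1 * ((1 + ξ) * K)) + (1 * K + 1 ^ 2 / 2)) ≤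
        Real.exp (1 / 2) * Real.exp (-(ξ ^ 2 * K ^ 2 / 2)) := by
      rw [← Real.exp_add]
      refine Real.exp_le_exp.2 ?_
      have : 0 ≤ ξ * K := by positivity
      nlinarith
    refine (mul_le_mul_of_nonneg_left e (by positivity)).trans ?_
    rw [← mul_assoc]
    refine mul_le_mul_of_nonneg_right ?_ (Real.exp_pos _).le
    have hh := exp_neg_half_le
    have hh0 := Real.exp_pos (-(1 / 2))
    have e4 : Real.exp (-1) * Real.exp (1 / 2) = Real.exp (-(1 / 2)) := by
      rw [← Real.exp_add]; norm_num
    have e5 : (2 * ((1 + ξ) * K) * Real.exp (-1) / 1 + 4 * Real.exp (-1) ^ 2 / 1 ^ 2) *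
        Real.exp (1 / 2) = 2 * ((1 + ξ) * K) * Real.exp (-(1 / 2)) +
          4 * (Real.exp (-1) * Real.exp (-(1 / 2))) := by
      rw [← e4]; ring
    rw [e5]
    have hKi : K ≤ ξ⁻¹ := by
      rw [← one_div, le_div_iff₀ hξ]; linarith
    have h6 : (1 + ξ) * K ≤ 1 + ξ⁻¹ := by nlinarith
    have h7 : Real.exp (-1) * Real.exp (-(1 / 2)) ≤ 0.368 * 0.61 :=
      mul_le_mul he1 hh hh0.le (by norm_num)
    have h8 : 2 * ((1 + ξ) * K) * Real.exp (-(1 / 2)) ≤ 2 * (1 + ξ⁻¹) * 0.61 :=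
      mul_le_mul (by linarith) hh hh0.le (by positivity)
    nlinarith

theorem integrable_specNorm_sq :
    Integrable (fun G => specNorm G ^ 2) (gaussPi (a × b)) := by
  have h := (integrable_exp_specNorm (a := a) (b := b) (zero_le_one)).const_mul
    ((2 * 0 * Real.exp (-1) / 1 + 4 * Real.exp (-1) ^ 2 / 1 ^ 2) * Real.exp (-(1 * 0)))
  refine h.mono' (measurable_specNorm.pow_const 2).aestronglyMeasurable (ae_of_all _ fun G => ?_)
  rw [Real.norm_eq_abs, abs_of_nonneg (sq_nonneg _)]
  refine le_trans ?_ (sq_sub_sq_le_exp le_rfl one_pos (specNorm_nonneg G))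
  refine le_max_of_le_right (le_of_eq (by ring))

theorem integral_specNorm_sq_le [Nonempty b] :
    ∫ G, specNorm G ^ 2 ∂(gaussPi (a × b)) ≤ (√(Fintype.card b) + √(Fintype.card a)) ^ 2 +
      2 * (√(Fintype.card b) + √(Fintype.card a)) + 2 := by
  set K : ℝ := √(Fintype.card b) + √(Fintype.card a) with hK
  have hK0 : 0 ≤ K := by positivity
  have h := integral_excess_specNorm_le_of_exp (a := a) (b := b) hK0 one_pos
  have hint : Integrable (fun G => max 0 (specNorm G ^ 2 - K ^ 2)) (gaussPi (a × b)) :=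
    (integrable_zero _ _ _).sup (integrable_specNorm_sq.sub (integrable_const _))
  calc ∫ G, specNorm G ^ 2 ∂(gaussPi (a × b))
      ≤ ∫ G, (K ^ 2 + max 0 (specNorm G ^ 2 - K ^ 2)) ∂(gaussPi (a × b)) := by
        refine integral_mono integrable_specNorm_sq ((integrable_const _).add hint) fun G => ?_
        simp only
        linarith [le_max_right 0 (specNorm G ^ 2 - K ^ 2)]
    _ = K ^ 2 + ∫ G, max 0 (specNorm G ^ 2 - K ^ 2) ∂(gaussPi (a × b)) := by
        rw [integral_add (integrable_const _) hint]; simp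
    _ ≤ _ := by
        rw [add_assoc]
        refine add_le_add_right (h.trans ?_) _
        have e : -(1 * K) + (1 * K + (1 : ℝ) ^ 2 / 2) = 1 / 2 := by ring
        have e4 : Real.exp (-1) * Real.exp (1 / 2) = Real.exp (-(1 / 2)) := by
          rw [← Real.exp_add]; norm_num
        have e5 : (2 * K * Real.exp (-1) / 1 + 4 * Real.exp (-1) ^ 2 / 1 ^ 2) *
            Real.exp (1 / 2) = 2 * K * Real.exp (-(1 / 2)) +
              4 * (Real.exp (-1) * Real.exp (-(1 / 2))) := by
          rw [← e4]; ring
        rw [← hK, e, e5]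
        have hh := exp_neg_half_le
        have hh0 := Real.exp_pos (-(1 / 2))
        have h7 : Real.exp (-1) * Real.exp (-(1 / 2)) ≤ 0.368 * 0.61 :=
          mul_le_mul exp_neg_one_le hh hh0.le (by norm_num)
        nlinarith

end SpecNormMoments

section ChiSquare

theorem integral_exp_neg_mul_sq_gaussianReal {s : ℝ} (hs : 0 ≤ s) :
    ∫ x, Real.exp (-s * x ^ 2) ∂(gaussianReal 0 1) = √(1 / (1 + 2 * s)) := by
  rw [integral_gaussianReal_eq_integral_smul one_ne_zero]
  have h : ∀ x : ℝ, gaussianPDFReal 0 1 x • Real.exp (-s * x ^ 2) =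
      (√(2 * Real.pi))⁻¹ * Real.exp (-(s + 1 / 2) * x ^ 2) := by
    intro x
    simp only [gaussianPDFReal, smul_eq_mul, NNReal.coe_one, mul_one, sub_zero]
    rw [mul_assoc, ← Real.exp_add]
    congr 2
    ring
  simp only [h]
  rw [integral_const_mul, integral_gaussian, ← Real.sqrt_inv, ← Real.sqrt_mul (by positivity)]
  congr 1
  have := Real.pi_pos
  field_simp
  ring

variable {κ : Type*} [Fintype κ]

theorem integral_exp_neg_mul_sum_sq_gaussPi {s : ℝ} (hs : 0 ≤ s) :
    ∫ h, Real.exp (-s * ∑ k, h k ^ 2) ∂(gaussPi κ) = √(1 / (1 + 2 * s)) ^ Fintype.card κ := by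
  have h := integral_fintype_prod_eq_prod (μ := fun _ : κ => gaussianReal 0 1)
    (f := fun (_ : κ) (x : ℝ) => Real.exp (-s * x ^ 2))
  simp only [integral_exp_neg_mul_sq_gaussianReal hs, Finset.prod_const, Finset.card_univ,
    ← Real.exp_sum, ← Finset.mul_sum] at h
  exact h

theorem one_sub_le_exp_neg {δ : ℝ} (hδ0 : 0 < δ) (hδ1 : δ < 1) :
    1 - δ ≤ Real.exp (-δ - δ ^ 2 / 2) := by
  have h := Real.hasSum_pow_div_log_of_abs_lt_one (x := δ) (by rw [abs_of_pos hδ0]; exact hδ1)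
  have h2 := sum_le_hasSum (Finset.range 2) (fun i _ => by positivity) h
  simp only [Finset.sum_range_succ, Finset.sum_range_zero] at h2
  norm_num at h2
  rw [← Real.log_le_iff_le_exp (by linarith)]
  linarith

/-- Lower tail of the chi-square distribution. -/
theorem measureReal_sum_sq_lt_le {δ : ℝ} (hδ0 : 0 < δ) (hδ1 : δ < 1) :
    (gaussPi κ).real {h | ∑ k, h k ^ 2 < (1 - δ) * Fintype.card κ} ≤
      Real.exp (-(δ ^ 2 * Fintype.card κ / 4)) := by
  set N : ℝ := (Fintype.card κ : ℝ) with hN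
  have h1 : 0 < 1 - δ := by linarith
  set s : ℝ := δ / (2 * (1 - δ)) with hs
  have hs0 : 0 ≤ s := by positivity
  have hset : MeasurableSet {h : κ → ℝ | ∑ k, h k ^ 2 < (1 - δ) * N} :=
    measurableSet_lt (by fun_prop) measurable_const
  have hint : Integrable (fun h : κ → ℝ => Real.exp (s * ((1 - δ) * N)) *
      Real.exp (-s * ∑ k, h k ^ 2)) (gaussPi κ) := by
    refine Integrable.const_mul ?_ _
    refine (integrable_const (1 : ℝ)).mono'
      (Measurable.aestronglyMeasurable (by fun_prop)) (ae_of_all _ fun h => ?_)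
    rw [Real.norm_eq_abs, Real.abs_exp, Real.exp_le_one_iff, neg_mul]
    exact neg_nonpos.2 (mul_nonneg hs0 (Finset.sum_nonneg fun _ _ => sq_nonneg _))
  have hle : (gaussPi κ).real {h | ∑ k, h k ^ 2 < (1 - δ) * N} ≤
      ∫ h, Real.exp (s * ((1 - δ) * N)) * Real.exp (-s * ∑ k, h k ^ 2) ∂(gaussPi κ) := by
    rw [← integral_indicator_one hset]
    refine integral_mono_of_nonneg (ae_of_all _ fun h => Set.indicator_nonneg
      (fun _ _ => zero_le_one) _) hint (ae_of_all _ fun h => ?_)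
    simp only
    by_cases hh : h ∈ {h : κ → ℝ | ∑ k, h k ^ 2 < (1 - δ) * N}
    · rw [Set.indicator_of_mem hh, Pi.one_apply, ← Real.exp_add]
      refine Real.one_le_exp ?_
      have : ∑ k, h k ^ 2 < (1 - δ) * N := hh
      nlinarith
    · rw [Set.indicator_of_notMem hh]; positivity
  refine hle.trans ?_
  rw [integral_const_mul, integral_exp_neg_mul_sum_sq_gaussPi hs0]
  have e1 : 1 / (1 + 2 * s) = 1 - δ := by
    rw [hs]; field_simp; ring
  have e2 : s * ((1 - δ) * N) = Fintype.card κ * (δ / 2) := by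
    rw [hs, hN]; field_simp
  have e3 : -(δ ^ 2 * N / 4) = Fintype.card κ * (-(δ ^ 2 / 4)) := by rw [hN]; ring
  rw [e1, e2, e3, Real.exp_nat_mul, Real.exp_nat_mul, ← mul_pow]
  refine pow_le_pow_left₀ (by positivity) ?_ _
  have h3 : √(1 - δ) ≤ Real.exp ((-δ - δ ^ 2 / 2) / 2) := by
    refine Real.sqrt_le_iff.2 ⟨(Real.exp_pos _).le, ?_⟩
    rw [← Real.exp_nat_mul]
    refine (one_sub_le_exp_neg hδ0 hδ1).trans (le_of_eq ?_)
    congr 1; push_cast; ring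
  refine (mul_le_mul_of_nonneg_left h3 (Real.exp_pos _).le).trans (le_of_eq ?_)
  rw [← Real.exp_add]
  congr 1; ring

theorem integrable_sq_coord_gaussPi (k : κ) : Integrable (fun h => h k ^ 2) (gaussPi κ) := by
  have := integrable_coord_mul_gaussPi_of_exp_growth (measurable_pi_apply (X := fun _ : κ => ℝ) k)
    1 1 (fun x => by rw [one_mul, one_mul]; exact abs_apply_le_exp x k) k
  simpa only [sq] using this

theorem integral_sum_sq_gaussPi : ∫ h, ∑ k, h k ^ 2 ∂(gaussPi κ) = Fintype.card κ := by
  classical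
  rw [integral_finsetSum _ fun k _ => integrable_sq_coord_gaussPi k]
  have : ∀ k : κ, ∫ h, h k ^ 2 ∂(gaussPi κ) = 1 := by
    intro k
    have h := integral_coord_mul_gaussPi k (f := fun x : κ → ℝ => x k) (f' := fun _ => 1)
      (fun x t => by simpa using hasDerivAt_id' t)
      (integrable_gaussPi_of_exp_growth (measurable_pi_apply (X := fun _ : κ => ℝ) k) 1 1
        (fun x => by rw [one_mul, one_mul]; exact abs_apply_le_exp x k))
      (integrable_const _) (by simpa only [sq] using integrable_sq_coord_gaussPi k)
    simpa [sq] using h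
  simp [this]

end ChiSquare

section Excess

variable {a b d : Type*} [Fintype a] [Fintype b] [DecidableEq b] [Fintype d]

/-- The excess of the squared spectral norm of `G` over a multiple of the variance estimate built
from `H`. -/
noncomputable def normExcess (ξ δ : ℝ) (z : (a × b → ℝ) × (d × b → ℝ)) : ℝ :=
  max 0 (specNorm z.1 ^ 2 - (1 + ξ) ^ 2 * (√(Fintype.card b) + √(Fintype.card a)) ^ 2 / (1 - δ) *
    ((∑ k, z.2 k ^ 2) / Fintype.card (d × b)))

theorem integrable_normExcess (ξ δ : ℝ) :
    Integrable (normExcess (a := a) (b := b) (d := d) ξ δ)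
      ((gaussPi (a × b)).prod (gaussPi (d × b))) := by
  refine (integrable_zero _ _ _).sup (Integrable.sub (integrable_specNorm_sq.comp_fst _)
    (Integrable.const_mul (Integrable.div_const ?_ _) _))
  exact (integrable_finsetSum Finset.univ fun k _ => integrable_sq_coord_gaussPi k).comp_snd _

theorem integral_normExcess_le [Nonempty b] [Nonempty d] {ξ δ : ℝ} (hξ : 0 < ξ) (hδ0 : 0 < δ)
    (hδ1 : δ < 1) :
    ∫ z, normExcess (a := a) (b := b) (d := d) ξ δ z
        ∂((gaussPi (a × b)).prod (gaussPi (d × b))) ≤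
      2 * (1 + ξ⁻¹) * Real.exp (-(ξ ^ 2 * (Fintype.card b + Fintype.card a) / 2)) +
      ((√(Fintype.card b) + √(Fintype.card a)) ^ 2 +
        2 * (√(Fintype.card b) + √(Fintype.card a)) + 2) *
        Real.exp (-(δ ^ 2 * Fintype.card (d × b) / 4)) := by
  set K : ℝ := √(Fintype.card b) + √(Fintype.card a) with hK
  set N : ℝ := (Fintype.card (d × b) : ℝ) with hN
  have hNpos : 0 < N := by rw [hN]; exact_mod_cast Fintype.card_pos
  set B : Set (d × b → ℝ) := {h | ∑ k, h k ^ 2 < (1 - δ) * N} with hB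
  have hBm : MeasurableSet B := measurableSet_lt (by fun_prop) measurable_const
  have i1 : Integrable (fun G => max 0 (specNorm G ^ 2 - ((1 + ξ) * K) ^ 2)) (gaussPi (a × b)) :=
    (integrable_zero _ _ _).sup (integrable_specNorm_sq.sub (integrable_const _))
  have i2 : Integrable (fun z : (a × b → ℝ) × (d × b → ℝ) =>
      specNorm z.1 ^ 2 * B.indicator (1 : (d × b → ℝ) → ℝ) z.2)
      ((gaussPi (a × b)).prod (gaussPi (d × b))) :=
    integrable_specNorm_sq.mul_prod ((integrable_const (1 : ℝ)).indicator hBm)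
  have hpt : ∀ z : (a × b → ℝ) × (d × b → ℝ), normExcess ξ δ z ≤
      max 0 (specNorm z.1 ^ 2 - ((1 + ξ) * K) ^ 2) +
        specNorm z.1 ^ 2 * B.indicator (1 : (d × b → ℝ) → ℝ) z.2 := by
    intro z
    have h1 : 0 < 1 - δ := by linarith
    unfold normExcess
    rw [← hK, ← hN]
    have hS : 0 ≤ ∑ k, z.2 k ^ 2 := Finset.sum_nonneg fun _ _ => sq_nonneg _
    by_cases hz : z.2 ∈ B
    · rw [Set.indicator_of_mem hz, Pi.one_apply, mul_one]
      have : 0 ≤ (1 + ξ) ^ 2 * K ^ 2 / (1 - δ) * ((∑ k, z.2 k ^ 2) / N) := by positivity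
      refine max_le (by positivity) ?_
      linarith [le_max_left 0 (specNorm z.1 ^ 2 - ((1 + ξ) * K) ^ 2)]
    · rw [Set.indicator_of_notMem hz, mul_zero, add_zero]
      refine max_le_max le_rfl (sub_le_sub_left ?_ _)
      have hz' : (1 - δ) * N ≤ ∑ k, z.2 k ^ 2 := not_lt.1 hz
      have h2 : 1 - δ ≤ (∑ k, z.2 k ^ 2) / N := by rwa [le_div_iff₀ hNpos]
      calc ((1 + ξ) * K) ^ 2 = (1 + ξ) ^ 2 * K ^ 2 / (1 - δ) * (1 - δ) := by
            field_simp
        _ ≤ _ := mul_le_mul_of_nonneg_left h2 (by positivity)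
  have i1' := i1.comp_fst (gaussPi (d × b))
  refine (integral_mono (integrable_normExcess ξ δ) (i1'.add i2) hpt).trans ?_
  have hadd := integral_add i1' i2
  simp only [Pi.add_apply]
  rw [hadd, integral_prod_mul (fun G : a × b → ℝ => specNorm G ^ 2)
    (B.indicator (1 : (d × b → ℝ) → ℝ)), integral_indicator_one hBm]
  refine add_le_add ?_ ?_
  · have := integral_prod_mul (μ := gaussPi (a × b)) (ν := gaussPi (d × b))
      (fun G : a × b → ℝ => max 0 (specNorm G ^ 2 - ((1 + ξ) * K) ^ 2)) (fun _ => (1 : ℝ))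
    simp only [mul_one, integral_const, probReal_univ, smul_eq_mul] at this
    rw [this]
    exact integral_excess_specNorm_le hξ
  · exact mul_le_mul integral_specNorm_sq_le (measureReal_sum_sq_lt_le hδ0 hδ1)
      measureReal_nonneg (by positivity)

end Excess

theorem finrank_range_toEuclideanLin {a b : Type*} [Fintype a] [Fintype b] [DecidableEq b]
    (C : Matrix a b ℝ) : Module.finrank ℝ (LinearMap.range (Matrix.toEuclideanLin C)) = C.rank := by
  rw [Matrix.rank_eq_finrank_range_toLin C (PiLp.basisFun 2 ℝ a) (PiLp.basisFun 2 ℝ b),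
    ← Matrix.toLpLin_eq_toLin]

/-- The columns of a matrix as Euclidean vectors. -/
noncomputable def colVec {a b : Type*} (M : Matrix a b ℝ) (j : b) : EuclideanSpace ℝ a :=
  WithLp.toLp 2 fun i => M i j

theorem toEuclideanLin_basisFun {a b : Type*} [Fintype b] [DecidableEq b]
    (M : Matrix a b ℝ) (j : b) :
    Matrix.toEuclideanLin M (EuclideanSpace.basisFun b ℝ j) = colVec M j := by
  ext i
  rw [Matrix.toLpLin_apply]
  simp [colVec]

theorem colVec_mul {a b d : Type*} [Fintype b] [DecidableEq b]
    (M : Matrix a b ℝ) (B : Matrix b d ℝ) (j : d) :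
    colVec (M * B) j = Matrix.toEuclideanLin M (colVec B j) := by
  ext i
  rw [Matrix.toLpLin_apply]
  simp [colVec, Matrix.mul_apply, Matrix.mulVec, dotProduct]

section Columns

variable {a b : Type*} [Fintype a] [Fintype b] [DecidableEq b]

theorem sum_norm_sq_toEuclideanLin {ι : Type*} [Fintype ι] (M : Matrix a b ℝ)
    (e : OrthonormalBasis ι ℝ (EuclideanSpace ℝ b)) :
    ∑ i, ‖Matrix.toEuclideanLin M (e i)‖ ^ 2 = ∑ i, ∑ j, M i j ^ 2 := by
  have h : ∀ x : EuclideanSpace ℝ b, ∀ i : a, Matrix.toEuclideanLin M x i =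
      inner ℝ x (WithLp.toLp 2 (M i) : EuclideanSpace ℝ b) := by
    intro x i
    rw [Matrix.toLpLin_apply, PiLp.inner_apply]
    simp [Matrix.mulVec, dotProduct]
  simp only [EuclideanSpace.real_norm_sq_eq, h]
  rw [Finset.sum_comm]
  refine Finset.sum_congr rfl fun i _ => ?_
  rw [e.sum_sq_inner_right, EuclideanSpace.real_norm_sq_eq]

/-- Trace duality between the spectral norm and matrices of a given rank. -/
theorem sum_mul_le_specNorm_mul_sqrt_rank (G : a × b → ℝ) (C : Matrix a b ℝ) :
    ∑ i, ∑ j, G (i, j) * C i j ≤ specNorm G * √(C.rank : ℝ) * √(∑ i, ∑ j, C i j ^ 2) := by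
  set W := LinearMap.range (Matrix.toEuclideanLin C) with hW
  set w := stdOrthonormalBasis ℝ W with hw
  let g : b → EuclideanSpace ℝ a := fun j => WithLp.toLp 2 fun i => G (i, j)
  have hcW : ∀ j, colVec C j ∈ W := fun j => by
    rw [← toEuclideanLin_basisFun]; exact LinearMap.mem_range_self _ _
  have hnorm : ∀ l, ‖(w l : EuclideanSpace ℝ a)‖ = 1 := fun l => by
    rw [Submodule.norm_coe]; exact w.orthonormal.1 l
  have hinner : ∑ i, ∑ j, G (i, j) * C i j =
      ∑ j, ∑ l, inner ℝ (g j) (w l : EuclideanSpace ℝ a) *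
        inner ℝ (w l : EuclideanSpace ℝ a) (colVec C j) := by
    rw [Finset.sum_comm]
    refine Finset.sum_congr rfl fun j _ => ?_
    have h1 : colVec C j = ∑ l, inner ℝ (w l : EuclideanSpace ℝ a) (colVec C j) •
        (w l : EuclideanSpace ℝ a) := by
      have := congrArg Subtype.val (w.sum_repr' ⟨colVec C j, hcW j⟩)
      simp only [Submodule.coe_sum, Submodule.coe_smul, Submodule.coe_inner] at this
      exact this.symm
    have h2 : ∑ i, G (i, j) * C i j = inner ℝ (g j) (colVec C j) := by
      rw [PiLp.inner_apply]
      exact Finset.sum_congr rfl fun i _ => by simp [g, colVec, mul_comm]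
    rw [h2]
    conv_lhs => rw [h1]
    rw [inner_sum]
    exact Finset.sum_congr rfl fun l _ => by rw [real_inner_smul_right, mul_comm]
  have hC : ∑ j, ∑ l, inner ℝ (w l : EuclideanSpace ℝ a) (colVec C j) ^ 2 =
      ∑ i, ∑ j, C i j ^ 2 := by
    rw [Finset.sum_comm (f := fun i j => C i j ^ 2)]
    refine Finset.sum_congr rfl fun j _ => ?_
    have h := w.sum_sq_inner_right ⟨colVec C j, hcW j⟩
    simp only [Submodule.coe_inner, Submodule.coe_norm] at h
    rw [h, EuclideanSpace.real_norm_sq_eq]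
    rfl
  have hG : ∑ j, ∑ l, inner ℝ (g j) (w l : EuclideanSpace ℝ a) ^ 2 ≤
      C.rank * specNorm G ^ 2 := by
    rw [Finset.sum_comm]
    have hcard : (C.rank : ℝ) = ∑ _l : Fin (Module.finrank ℝ W), (1 : ℝ) := by
      rw [Finset.sum_const, Finset.card_univ, Fintype.card_fin, nsmul_eq_mul, mul_one, hW,
        finrank_range_toEuclideanLin]
    rw [hcard, Finset.sum_mul]
    refine Finset.sum_le_sum fun l _ => ?_
    rw [one_mul]
    set y : EuclideanSpace ℝ b := WithLp.toLp 2 fun j => inner ℝ (g j) (w l : EuclideanSpace ℝ a)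
      with hy
    have hy2 : ∑ j, inner ℝ (g j) (w l : EuclideanSpace ℝ a) ^ 2 = ‖y‖ ^ 2 := by
      rw [EuclideanSpace.real_norm_sq_eq]
    have hb : bilinPair G (w l : EuclideanSpace ℝ a) y = ‖y‖ ^ 2 := by
      rw [← hy2, bilinPair, Fintype.sum_prod_type, Finset.sum_comm]
      refine Finset.sum_congr rfl fun j _ => ?_
      have : inner ℝ (g j) (w l : EuclideanSpace ℝ a) =
          ∑ i, (w l : EuclideanSpace ℝ a) i * G (i, j) := by
        rw [PiLp.inner_apply]
        exact Finset.sum_congr rfl fun i _ => by simp [g]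
      rw [sq]
      conv_rhs => rw [this, Finset.sum_mul, ← this]
      exact Finset.sum_congr rfl fun i _ => by simp only [hy]; ring
    have hle := bilinPair_le_specNorm G (w l : EuclideanSpace ℝ a) y
    rw [hb, hnorm, mul_one] at hle
    rw [hy2]
    have h0 := norm_nonneg y
    have h1 := specNorm_nonneg G
    rcases h0.eq_or_lt with h | h
    · rw [← h, zero_pow two_ne_zero]; exact sq_nonneg _
    · have : ‖y‖ ≤ specNorm G := by
        refine le_of_mul_le_mul_right ?_ h
        rwa [sq] at hle
      exact pow_le_pow_left₀ h0 this 2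
  rw [hinner]
  have hcs := Finset.sum_mul_sq_le_sq_mul_sq (Finset.univ : Finset (b × Fin (Module.finrank ℝ W)))
    (fun z => inner ℝ (g z.1) (w z.2 : EuclideanSpace ℝ a))
    (fun z => inner ℝ (w z.2 : EuclideanSpace ℝ a) (colVec C z.1))
  simp only [Fintype.sum_prod_type] at hcs
  rw [hC] at hcs
  have hS0 : 0 ≤ ∑ i, ∑ j, C i j ^ 2 :=
    Finset.sum_nonneg fun _ _ => Finset.sum_nonneg fun _ _ => sq_nonneg _
  refine abs_le_of_sq_le_sq' ?_
    (mul_nonneg (mul_nonneg (specNorm_nonneg G) (Real.sqrt_nonneg _)) (Real.sqrt_nonneg _)) |>.2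
  rw [mul_pow, mul_pow, Real.sq_sqrt hS0, Real.sq_sqrt (Nat.cast_nonneg _)]
  refine hcs.trans (mul_le_mul_of_nonneg_right (hG.trans (le_of_eq (mul_comm _ _))) hS0)

end Columns

/-- Best approximation by matrices of rank at most `k`: right multiplication by the projection
onto the leading right singular vectors of `X * A`. -/
theorem exists_rank_le_frobSq_eq_tailSingSq {m n p : ℕ} (X : Matrix (Fin m) (Fin p) ℝ)
    (A : Matrix (Fin p) (Fin n) ℝ) (k : ℕ) :
    ∃ B : Matrix (Fin p) (Fin n) ℝ, B.rank ≤ k ∧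
      frobSq (X * B - X * A) = tailSingSq (X * A) k := by
  set T := Matrix.toEuclideanLin (X * A) with hT
  have hn : Module.finrank ℝ (EuclideanSpace ℝ (Fin n)) = n := by simp
  set e := T.isSymmetric_adjoint_comp_self.eigenvectorBasis hn with he
  let f : Fin n → EuclideanSpace ℝ (Fin n) := fun i => if (i : ℕ) < k then e i else 0
  let L : EuclideanSpace ℝ (Fin n) →ₗ[ℝ] EuclideanSpace ℝ (Fin n) := e.toBasis.constr ℝ f
  have hL : ∀ i, L (e i) = f i := fun i => by
    have := e.toBasis.constr_basis ℝ f i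
    rwa [e.coe_toBasis] at this
  set Q : Matrix (Fin n) (Fin n) ℝ := Matrix.toEuclideanLin.symm L with hQ
  have hQL : Matrix.toEuclideanLin Q = L := LinearEquiv.apply_symm_apply _ _
  have hrank : Q.rank ≤ k := by
    rw [← finrank_range_toEuclideanLin, hQL]
    have hsub : LinearMap.range L ≤ Submodule.span ℝ
        (((Finset.univ.filter fun i : Fin n => (i : ℕ) < k).image e : Finset _) : Set _) := by
      rw [Module.Basis.constr_range, Submodule.span_le]
      rintro _ ⟨i, rfl⟩
      by_cases hi : (i : ℕ) < k
      · simp only [f, if_pos hi]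
        refine Submodule.subset_span ?_
        rw [Finset.mem_coe, Finset.mem_image]
        exact ⟨i, by simpa using hi, rfl⟩
      · simp only [f, if_neg hi]
        exact Submodule.zero_mem _
    refine (Submodule.finrank_mono hsub).trans ((finrank_span_finset_le_card _).trans
      (Finset.card_image_le.trans ?_))
    rw [Fin.card_filter_val_lt]
    exact min_le_right _ _
  refine ⟨A * Q, (Matrix.rank_mul_le_right A Q).trans hrank, ?_⟩
  have hval : ∀ i, Matrix.toEuclideanLin (X * (A * Q) - X * A) (e i) =
      if (i : ℕ) < k then 0 else -T (e i) := by
    intro i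
    rw [← Matrix.mul_assoc, map_sub, LinearMap.sub_apply, Matrix.toLpLin_mul_same,
      LinearMap.comp_apply, hQL, hL, ← hT]
    simp only [f]
    split_ifs <;> simp
  have hTe : ∀ i : Fin n, ‖T (e i)‖ ^ 2 = T.singularValues i ^ 2 := by
    intro i
    rw [T.sq_singularValues_fin hn, ← real_inner_self_eq_norm_sq,
      ← LinearMap.adjoint_inner_left, ← LinearMap.comp_apply,
      LinearMap.IsSymmetric.apply_eigenvectorBasis, real_inner_smul_left,
      real_inner_self_eq_norm_sq, e.orthonormal.1]
    simp
  rw [frobSq, ← sum_norm_sq_toEuclideanLin _ e, tailSingSq, ← hT]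
  have hsum : ∀ i : Fin n, ‖Matrix.toEuclideanLin (X * (A * Q) - X * A) (e i)‖ ^ 2 =
      (fun i : ℕ => if i < k then 0 else T.singularValues i ^ 2) i := by
    intro i
    rw [hval]
    simp only
    split_ifs
    · simp
    · rw [norm_neg, hTe]
  rw [Finset.sum_congr rfl fun i _ => hsum i]
  refine (Fin.sum_univ_eq_sum_range
    (fun i : ℕ => if i < k then 0 else T.singularValues i ^ 2) n).trans ?_
  rw [Finset.sum_ite, Finset.sum_const_zero, zero_add]
  refine Finset.sum_congr ?_ fun _ _ => rfl
  ext i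
  simp only [Finset.mem_filter, Finset.mem_range, Finset.mem_Ico]
  lia

/-- An orthonormal basis of `ℝ^m` adapted to a subspace and its orthogonal complement. -/
theorem exists_orthonormalBasis_adapted {m : ℕ} (hm : 0 < m)
    (V : Submodule ℝ (EuclideanSpace ℝ (Fin m))) :
    ∃ b : OrthonormalBasis (Fin (Module.finrank ℝ V) ⊕ Fin (m - Module.finrank ℝ V)) ℝ
        (EuclideanSpace ℝ (Fin m)),
      (∀ i, b (Sum.inl i) ∈ V) ∧ ∀ i, b (Sum.inr i) ∈ Vᗮ := by
  have hfin : Module.finrank ℝ Vᗮ = m - Module.finrank ℝ V := by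
    have := V.finrank_add_finrank_orthogonal
    rw [finrank_euclideanSpace_fin] at this
    omega
  have hle : Module.finrank ℝ V ≤ m := by
    have := V.finrank_le
    rwa [finrank_euclideanSpace_fin] at this
  let b₁ := stdOrthonormalBasis ℝ V
  let b₂ := (stdOrthonormalBasis ℝ Vᗮ).reindex (finCongr hfin)
  let v : Fin (Module.finrank ℝ V) ⊕ Fin (m - Module.finrank ℝ V) → EuclideanSpace ℝ (Fin m) :=
    Sum.elim (fun i => (b₁ i : EuclideanSpace ℝ (Fin m))) fun i => b₂ i
  have hv : Orthonormal ℝ v := by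
    have h1 := orthonormal_iff_ite.1 b₁.orthonormal
    have h2 := orthonormal_iff_ite.1 b₂.orthonormal
    rw [orthonormal_iff_ite]
    rintro (i | i) (j | j)
    · simpa [v] using h1 i j
    · simpa [v] using Submodule.inner_right_of_mem_orthogonal (b₁ i).2 (b₂ j).2
    · simpa [v] using Submodule.inner_left_of_mem_orthogonal (b₁ j).2 (b₂ i).2
    · simpa [v] using h2 i j
  have hcard : Fintype.card (Fin (Module.finrank ℝ V) ⊕ Fin (m - Module.finrank ℝ V)) =
      Module.finrank ℝ (EuclideanSpace ℝ (Fin m)) := by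
    rw [Fintype.card_sum, Fintype.card_fin, Fintype.card_fin, finrank_euclideanSpace_fin]
    omega
  have : Nonempty (Fin (Module.finrank ℝ V) ⊕ Fin (m - Module.finrank ℝ V)) := by
    rw [← Fintype.card_pos_iff, hcard, finrank_euclideanSpace_fin]; exact hm
  have hspan : ⊤ ≤ Submodule.span ℝ (Set.range v) := by
    rw [← coe_basisOfOrthonormalOfCardEqFinrank hv hcard, Module.Basis.span_eq]
  refine ⟨OrthonormalBasis.mk hv hspan, fun i => ?_, fun i => ?_⟩
  · rw [OrthonormalBasis.coe_mk]; exact (b₁ i).2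
  · rw [OrthonormalBasis.coe_mk]; exact (b₂ i).2

section Law

variable {ι κ : Type*} [Fintype ι] [Fintype κ]

/-- The coordinates of a standard Gaussian vector in an orthonormal basis are standard Gaussian. -/
theorem map_gaussPi_orthonormalBasis (w : OrthonormalBasis κ ℝ (EuclideanSpace ℝ ι)) :
    (gaussPi ι).map (fun g k => ∑ i, w k i * g i) = gaussPi κ := by
  have h1 : (gaussPi ι).map (WithLp.toLp 2) = stdGaussian (EuclideanSpace ℝ ι) :=
    map_pi_eq_stdGaussian
  have h2 : (gaussPi κ).map (WithLp.toLp 2) = stdGaussian (EuclideanSpace ℝ κ) :=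
    map_pi_eq_stdGaussian
  have h3 := stdGaussian_map w.repr
  rw [← h1, ← h2, Measure.map_map (by fun_prop) (by fun_prop)] at h3
  have h4 := congrArg (Measure.map (WithLp.ofLp (p := 2))) h3
  rw [Measure.map_map (by fun_prop) (by fun_prop), Measure.map_map (by fun_prop) (by fun_prop)]
    at h4
  have e1 : (WithLp.ofLp (p := 2)) ∘ (WithLp.toLp 2 : (κ → ℝ) → EuclideanSpace ℝ κ) = id := rfl
  rw [e1, Measure.map_id] at h4
  rw [← h4]
  congr 1
  funext g k
  simp only [Function.comp_apply, w.repr_apply_apply, PiLp.inner_apply]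
  exact Finset.sum_congr rfl fun i _ => by simp [mul_comm]

end Law

section Coordinates

variable {m n : ℕ} {ι : Type*} [Fintype ι]

/-- The coordinates of the columns of `M` along the vectors `b`. -/
noncomputable def colCoord (b : ι → EuclideanSpace ℝ (Fin m)) (M : Matrix (Fin m) (Fin n) ℝ)
    (k : ι × Fin n) : ℝ := inner ℝ (b k.1) (colVec M k.2)

theorem sum_colCoord_mul (b : OrthonormalBasis ι ℝ (EuclideanSpace ℝ (Fin m)))
    (M N : Matrix (Fin m) (Fin n) ℝ) :
    ∑ k, colCoord b M k * colCoord b N k = ∑ i, ∑ j, M i j * N i j := by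
  rw [Fintype.sum_prod_type, Finset.sum_comm, Finset.sum_comm (f := fun i j => M i j * N i j)]
  refine Finset.sum_congr rfl fun j _ => ?_
  have h := b.sum_inner_mul_inner (colVec M j) (colVec N j)
  simp only [colCoord]
  rw [Finset.sum_congr rfl fun i _ => by rw [real_inner_comm (colVec M j)], h, PiLp.inner_apply]
  exact Finset.sum_congr rfl fun i _ => by simp [colVec, mul_comm]

theorem sum_colCoord_sq (b : OrthonormalBasis ι ℝ (EuclideanSpace ℝ (Fin m)))
    (M : Matrix (Fin m) (Fin n) ℝ) : ∑ k, colCoord b M k ^ 2 = frobSq M := by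
  simp only [sq, sum_colCoord_mul]
  simp [frobSq, sq]

theorem colVec_sub (M N : Matrix (Fin m) (Fin n) ℝ) (j : Fin n) :
    colVec (M - N) j = colVec M j - colVec N j := rfl

theorem colVec_add (M N : Matrix (Fin m) (Fin n) ℝ) (j : Fin n) :
    colVec (M + N) j = colVec M j + colVec N j := rfl

end Coordinates

section Adapted

variable {m n p : ℕ} {X : Matrix (Fin m) (Fin p) ℝ} {a d : Type*} [Fintype a] [Fintype d]
  {b : OrthonormalBasis (a ⊕ d) ℝ (EuclideanSpace ℝ (Fin m))}

theorem colVec_mul_mem_range (X : Matrix (Fin m) (Fin p) ℝ) (D : Matrix (Fin p) (Fin n) ℝ)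
    (j : Fin n) : colVec (X * D) j ∈ LinearMap.range (Matrix.toEuclideanLin X) := by
  rw [colVec_mul]; exact LinearMap.mem_range_self _ _

theorem colCoord_inr_mul (hr : ∀ i, b (Sum.inr i) ∈ (LinearMap.range (Matrix.toEuclideanLin X))ᗮ)
    (D : Matrix (Fin p) (Fin n) ℝ) (i : d) (j : Fin n) :
    colCoord b (X * D) (Sum.inr i, j) = 0 :=
  Submodule.inner_left_of_mem_orthogonal (colVec_mul_mem_range X D j) (hr i)

/-- The residual sum of squares depends only on the noise orthogonal to the column space. -/
theorem frobSq_sub_colProj_mul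
    (hl : ∀ i, b (Sum.inl i) ∈ LinearMap.range (Matrix.toEuclideanLin X))
    (hr : ∀ i, b (Sum.inr i) ∈ (LinearMap.range (Matrix.toEuclideanLin X))ᗮ)
    (A : Matrix (Fin p) (Fin n) ℝ) (E : Matrix (Fin m) (Fin n) ℝ) :
    frobSq ((X * A + E) - colProj X * (X * A + E)) =
      ∑ k : d × Fin n, colCoord (fun i => b (Sum.inr i)) E k ^ 2 := by
  set V := LinearMap.range (Matrix.toEuclideanLin X) with hV
  set Y := X * A + E with hY
  have hcol : ∀ j, colVec (Y - colProj X * Y) j = colVec Y j - V.starProjection (colVec Y j) := by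
    intro j
    rw [colVec_sub, colVec_mul, colProj, LinearEquiv.apply_symm_apply]
    rfl
  rw [← sum_colCoord_sq b, Fintype.sum_prod_type, Fintype.sum_sum_type, Fintype.sum_prod_type]
  have h1 : ∑ i : a, ∑ j, colCoord b (Y - colProj X * Y) (Sum.inl i, j) ^ 2 = 0 := by
    refine Finset.sum_eq_zero fun i _ => Finset.sum_eq_zero fun j _ => ?_
    simp only [colCoord]
    rw [hcol, Submodule.inner_right_of_mem_orthogonal (hl i)
      (Submodule.sub_starProjection_mem_orthogonal _)]
    norm_num
  rw [h1, zero_add]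
  refine Finset.sum_congr rfl fun i _ => Finset.sum_congr rfl fun j _ => ?_
  simp only [colCoord]
  rw [hcol, inner_sub_right, Submodule.inner_left_of_mem_orthogonal
    (V.starProjection_apply_mem _) (hr i), sub_zero, hY, colVec_add, inner_add_right,
    Submodule.inner_left_of_mem_orthogonal (colVec_mul_mem_range X A j) (hr i), zero_add]

theorem sum_mul_le_specNorm_colCoord
    (hr : ∀ i, b (Sum.inr i) ∈ (LinearMap.range (Matrix.toEuclideanLin X))ᗮ)
    (E : Matrix (Fin m) (Fin n) ℝ) (D : Matrix (Fin p) (Fin n) ℝ) :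
    ∑ i, ∑ j, E i j * (X * D) i j ≤
      specNorm (colCoord (fun i => b (Sum.inl i)) E) * √(D.rank : ℝ) * √(frobSq (X * D)) := by
  let R : Matrix a (Fin m) ℝ := Matrix.of fun i l => b (Sum.inl i) l
  set C : Matrix a (Fin n) ℝ := R * (X * D) with hC
  have hCe : ∀ i j, C i j = colCoord b (X * D) (Sum.inl i, j) := by
    intro i j
    rw [hC, Matrix.mul_apply, colCoord, PiLp.inner_apply]
    exact Finset.sum_congr rfl fun l _ => by simp [R, colVec, mul_comm]
  have hrank : (C.rank : ℝ) ≤ D.rank := by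
    exact_mod_cast (Matrix.rank_mul_le_right R (X * D)).trans (Matrix.rank_mul_le_right X D)
  have hfrob : ∑ i, ∑ j, C i j ^ 2 = frobSq (X * D) := by
    rw [← sum_colCoord_sq b, Fintype.sum_prod_type, Fintype.sum_sum_type]
    have : ∑ i : d, ∑ j, colCoord b (X * D) (Sum.inr i, j) ^ 2 = 0 :=
      Finset.sum_eq_zero fun i _ => Finset.sum_eq_zero fun j _ => by
        rw [colCoord_inr_mul hr]; norm_num
    rw [this, add_zero]
    exact Finset.sum_congr rfl fun i _ => Finset.sum_congr rfl fun j _ => by rw [hCe]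
  have hinner : ∑ i, ∑ j, E i j * (X * D) i j =
      ∑ i, ∑ j, colCoord (fun i => b (Sum.inl i)) E (i, j) * C i j := by
    rw [← sum_colCoord_mul b, Fintype.sum_prod_type, Fintype.sum_sum_type]
    have : ∑ i : d, ∑ j, colCoord b E (Sum.inr i, j) * colCoord b (X * D) (Sum.inr i, j) = 0 :=
      Finset.sum_eq_zero fun i _ => Finset.sum_eq_zero fun j _ => by
        rw [colCoord_inr_mul hr, mul_zero]
    rw [this, add_zero]
    exact Finset.sum_congr rfl fun i _ => Finset.sum_congr rfl fun j _ => by rw [hCe]; rfl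
  rw [hinner, ← hfrob]
  refine (sum_mul_le_specNorm_mul_sqrt_rank _ C).trans ?_
  have := specNorm_nonneg (colCoord (fun i => b (Sum.inl i)) E)
  gcongr

/-- The `m × n` matrix whose column `k.2` is `b k.1` and whose other columns vanish. -/
noncomputable def blockVec {κ : Type*} (b : κ → EuclideanSpace ℝ (Fin m)) (k : κ × Fin n) :
    EuclideanSpace ℝ (Fin m × Fin n) :=
  WithLp.toLp 2 fun il => if il.2 = k.2 then b k.1 il.1 else 0

theorem sum_blockVec_mul {κ : Type*} (b : κ → EuclideanSpace ℝ (Fin m)) (k : κ × Fin n)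
    (g : Fin m × Fin n → ℝ) :
    ∑ il, blockVec b k il * g il = ∑ i, b k.1 i * g (i, k.2) := by
  simp [blockVec, Fintype.sum_prod_type]

theorem orthonormal_blockVec {κ : Type*} {b : κ → EuclideanSpace ℝ (Fin m)} (hb : Orthonormal ℝ b) :
    Orthonormal ℝ (blockVec (n := n) b) := by
  classical
  have h := orthonormal_iff_ite.1 hb
  rw [orthonormal_iff_ite]
  rintro ⟨i, j⟩ ⟨i', j'⟩
  have h' := h i i'
  rw [PiLp.inner_apply] at h' ⊢
  simp only [RCLike.inner_apply, conj_trivial, Fintype.sum_prod_type, blockVec] at h' ⊢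
  by_cases hj : j = j'
  · subst hj
    simpa using h'
  · simp [hj]

/-- The coordinates of a standard Gaussian matrix along two complementary orthonormal systems are
independent standard Gaussian matrices. -/
theorem map_gaussPi_blocks (hm : 0 < m) (hn : 0 < n)
    (b : OrthonormalBasis (a ⊕ d) ℝ (EuclideanSpace ℝ (Fin m))) :
    (gaussPi (Fin m × Fin n)).map (fun g =>
      ((fun k : a × Fin n => ∑ i, b (Sum.inl k.1) i * g (i, k.2)),
        (fun k : d × Fin n => ∑ i, b (Sum.inr k.1) i * g (i, k.2)))) =
      (gaussPi (a × Fin n)).prod (gaussPi (d × Fin n)) := by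
  have hτ : Function.Injective (Sum.elim (fun k : a × Fin n => ((Sum.inl k.1 : a ⊕ d), k.2))
      fun k : d × Fin n => (Sum.inr k.1, k.2)) := by
    rintro (⟨i, j⟩ | ⟨i, j⟩) (⟨i', j'⟩ | ⟨i', j'⟩) h <;> simp_all
  have ho := (orthonormal_blockVec (n := n) b.orthonormal).comp _ hτ
  have hcard : Fintype.card ((a × Fin n) ⊕ (d × Fin n)) =
      Module.finrank ℝ (EuclideanSpace ℝ (Fin m × Fin n)) := by
    have h1 := Module.finrank_eq_card_basis b.toBasis
    rw [finrank_euclideanSpace_fin, Fintype.card_sum] at h1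
    rw [finrank_euclideanSpace, Fintype.card_sum, Fintype.card_prod, Fintype.card_prod,
      Fintype.card_prod, Fintype.card_fin, Fintype.card_fin, h1, add_mul]
  have : Nonempty ((a × Fin n) ⊕ (d × Fin n)) := by
    rw [← Fintype.card_pos_iff, hcard, finrank_euclideanSpace, Fintype.card_prod, Fintype.card_fin,
      Fintype.card_fin]
    positivity
  have hspan : ⊤ ≤ Submodule.span ℝ (Set.range _) :=
    ((basisOfOrthonormalOfCardEqFinrank ho hcard).span_eq.symm.trans
      (by rw [coe_basisOfOrthonormalOfCardEqFinrank ho hcard])).le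
  have hmap := map_gaussPi_orthonormalBasis (OrthonormalBasis.mk ho hspan)
  rw [← (measurePreserving_gaussPi_sum (a × Fin n) (d × Fin n)).map_eq, ← hmap,
    Measure.map_map (measurePreserving_gaussPi_sum _ _).measurable (by fun_prop)]
  congr 1
  funext g
  simp only [Function.comp_apply, OrthonormalBasis.coe_mk, Prod.mk.injEq]
  constructor
  · funext k
    exact (sum_blockVec_mul b (Sum.inl k.1, k.2) g).symm
  · funext k
    exact (sum_blockVec_mul b (Sum.inr k.1, k.2) g).symm

end Adapted

theorem exists_orthonormalBasis_range {m p : ℕ} (hm : 0 < m) (X : Matrix (Fin m) (Fin p) ℝ) :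
    ∃ b : OrthonormalBasis (Fin X.rank ⊕ Fin (m - X.rank)) ℝ (EuclideanSpace ℝ (Fin m)),
      (∀ i, b (Sum.inl i) ∈ LinearMap.range (Matrix.toEuclideanLin X)) ∧
      ∀ i, b (Sum.inr i) ∈ (LinearMap.range (Matrix.toEuclideanLin X))ᗮ := by
  have h := exists_orthonormalBasis_adapted hm (LinearMap.range (Matrix.toEuclideanLin X))
  rwa [finrank_range_toEuclideanLin X] at h

section Noise

variable {Ω : Type*} [MeasurableSpace Ω] {Pr : Measure Ω} [IsProbabilityMeasure Pr] {m n : ℕ}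

theorem map_standardized_noise {σ : ℝ≥0} (hσ : 0 < σ) {E : Ω → Matrix (Fin m) (Fin n) ℝ}
    (hE_law : ∀ i j, HasLaw (fun ω => E ω i j) (gaussianReal 0 (σ ^ 2)) Pr)
    (hE_indep : iIndepFun (fun (ij : Fin m × Fin n) (ω : Ω) => E ω ij.1 ij.2) Pr) :
    Pr.map (fun ω (ij : Fin m × Fin n) => E ω ij.1 ij.2 / σ) = gaussPi (Fin m × Fin n) := by
  have hae : ∀ ij : Fin m × Fin n, AEMeasurable (fun ω => E ω ij.1 ij.2 / (σ : ℝ)) Pr :=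
    fun ij => (hE_law ij.1 ij.2).aemeasurable.div_const _
  have hind : iIndepFun (fun (ij : Fin m × Fin n) (ω : Ω) => E ω ij.1 ij.2 / (σ : ℝ)) Pr :=
    hE_indep.comp (fun _ x => x / (σ : ℝ)) fun _ => by fun_prop
  rw [(iIndepFun_iff_map_fun_eq_pi_map hae).1 hind, gaussPi]
  congr 1
  funext ij
  have h : Pr.map (fun ω => E ω ij.1 ij.2 / (σ : ℝ)) =
      (Pr.map fun ω => E ω ij.1 ij.2).map (fun x => x / (σ : ℝ)) := by
    rw [AEMeasurable.map_map_of_aemeasurable (by fun_prop) (hE_law ij.1 ij.2).aemeasurable]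
    rfl
  rw [h, (hE_law ij.1 ij.2).map_eq, gaussianReal_map_div_const, zero_div]
  congr 1
  have hσ' : σ ^ 2 ≠ 0 := pow_ne_zero 2 hσ.ne'
  have : (NNReal.mk ((σ : ℝ) ^ 2) (sq_nonneg _) : ℝ≥0) = σ ^ 2 := by ext; simp
  rw [this, div_self hσ']

end Noise

section Oracle

variable {m n p : ℕ}

theorem sqrt_frobSq_eq_norm (M : Matrix (Fin m) (Fin n) ℝ) :
    √(frobSq M) = ‖(WithLp.toLp 2 fun ij : Fin m × Fin n => M ij.1 ij.2 :
      EuclideanSpace ℝ (Fin m × Fin n))‖ := by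
  rw [EuclideanSpace.norm_eq, Fintype.sum_prod_type, frobSq]
  simp

theorem frobSq_nonneg (M : Matrix (Fin m) (Fin n) ℝ) : 0 ≤ frobSq M :=
  Finset.sum_nonneg fun _ _ => Finset.sum_nonneg fun _ _ => sq_nonneg _

theorem sqrt_frobSq_sub_le (M N : Matrix (Fin m) (Fin n) ℝ) :
    √(frobSq (M - N)) ≤ √(frobSq M) + √(frobSq N) := by
  simp only [sqrt_frobSq_eq_norm]
  exact norm_sub_le
    (WithLp.toLp 2 fun ij : Fin m × Fin n => M ij.1 ij.2 : EuclideanSpace ℝ (Fin m × Fin n))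
    (WithLp.toLp 2 fun ij : Fin m × Fin n => N ij.1 ij.2)

theorem frobSq_add (M N : Matrix (Fin m) (Fin n) ℝ) :
    frobSq (M + N) = frobSq M + 2 * ∑ i, ∑ j, M i j * N i j + frobSq N := by
  simp only [frobSq, Finset.mul_sum, ← Finset.sum_add_distrib, Matrix.add_apply]
  exact Finset.sum_congr rfl fun i _ => Finset.sum_congr rfl fun j _ => by ring

theorem frobSq_neg (M : Matrix (Fin m) (Fin n) ℝ) : frobSq (-M) = frobSq M := by
  simp [frobSq]

theorem quadratic_oracle {θ c u v D P : ℝ} (hθ : 0 < θ) (hc : c = 1 + 2 / θ)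
    (h : u ^ 2 ≤ v ^ 2 + 2 * (D * (u + v)) + P) :
    u ^ 2 ≤ c ^ 2 * v ^ 2 + c * (1 + θ) * D ^ 2 + c * P := by
  have hθ' := hθ.ne'
  have hc0 : 0 < c := by rw [hc]; positivity
  have h0 := mul_le_mul_of_nonneg_left h hc0.le
  have h1 := mul_nonneg (by positivity : 0 ≤ 2 / θ) (sq_nonneg (u - (1 + θ / 2) * D))
  have h2 := mul_nonneg (by positivity : 0 ≤ 2 / θ * c) (sq_nonneg (v - θ / 2 * D))
  have e : c ^ 2 * v ^ 2 + c * (1 + θ) * D ^ 2 + c * P - u ^ 2 =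
      (c * (v ^ 2 + 2 * (D * (u + v)) + P) - c * u ^ 2) + 2 / θ * (u - (1 + θ / 2) * D) ^ 2 +
        2 / θ * c * (v - θ / 2 * D) ^ 2 := by
    rw [hc]
    field_simp
    ring
  linarith

theorem matrix_rank_sub_le (C D : Matrix (Fin p) (Fin n) ℝ) :
    (C - D).rank ≤ C.rank + D.rank := by
  have hsub : LinearMap.range (C - D).mulVecLin ≤
      LinearMap.range C.mulVecLin ⊔ LinearMap.range D.mulVecLin := by
    rintro _ ⟨x, rfl⟩
    rw [Matrix.mulVecLin_apply, Matrix.sub_mulVec]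
    exact Submodule.sub_mem _ (Submodule.mem_sup_left ⟨x, rfl⟩) (Submodule.mem_sup_right ⟨x, rfl⟩)
  exact (Submodule.finrank_mono hsub).trans (Submodule.finrank_add_le_finrank_add_finrank _ _)

/-- The deterministic oracle inequality behind penalized rank selection. -/
theorem frobSq_le_of_isAdaptiveRSC {θ ξ δ c s : ℝ} (hθ : 0 < θ) (hc : c = 1 + 2 / θ)
    {X : Matrix (Fin m) (Fin p) ℝ} {A : Matrix (Fin p) (Fin n) ℝ} {E : Matrix (Fin m) (Fin n) ℝ}
    {Ah : Matrix (Fin p) (Fin n) ℝ} (hmin : IsAdaptiveRSC θ ξ δ X (X * A + E) Ah)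
    (hs : 0 ≤ s)
    (hdual : ∀ D : Matrix (Fin p) (Fin n) ℝ,
      ∑ i, ∑ j, E i j * (X * D) i j ≤ s * √(D.rank : ℝ) * √(frobSq (X * D)))
    (B : Matrix (Fin p) (Fin n) ℝ) :
    frobSq (X * Ah - X * A) ≤ c ^ 2 * frobSq (X * B - X * A) +
      c * (1 + θ) * (s ^ 2 * ((Ah.rank : ℝ) + B.rank)) +
      c * (adaptivePen θ ξ δ X (X * A + E) B - adaptivePen θ ξ δ X (X * A + E) Ah) := by
  have h := hmin B
  have hexp : ∀ C : Matrix (Fin p) (Fin n) ℝ, frobSq (X * A + E - X * C) =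
      frobSq E + 2 * ∑ i, ∑ j, E i j * (X * A - X * C) i j + frobSq (X * C - X * A) := by
    intro C
    rw [show X * A + E - X * C = E + (X * A - X * C) by abel, frobSq_add,
      ← frobSq_neg (X * A - X * C), neg_sub]
  rw [hexp, hexp] at h
  have hin : ∑ i, ∑ j, E i j * (X * A - X * B) i j - ∑ i, ∑ j, E i j * (X * A - X * Ah) i j =
      ∑ i, ∑ j, E i j * (X * (Ah - B)) i j := by
    rw [Matrix.mul_sub]
    simp only [← Finset.sum_sub_distrib, Matrix.sub_apply]
    exact Finset.sum_congr rfl fun i _ => Finset.sum_congr rfl fun j _ => by ring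
  have hd := hdual (Ah - B)
  have hrank : ((Ah - B).rank : ℝ) ≤ (Ah.rank : ℝ) + B.rank := by
    exact_mod_cast matrix_rank_sub_le Ah B
  have htri : √(frobSq (X * (Ah - B))) ≤
      √(frobSq (X * Ah - X * A)) + √(frobSq (X * B - X * A)) := by
    refine le_trans (le_of_eq ?_) (sqrt_frobSq_sub_le _ _)
    rw [Matrix.mul_sub]
    congr 2
    abel
  set u := √(frobSq (X * Ah - X * A)) with hu
  set v := √(frobSq (X * B - X * A)) with hv
  have hu2 : frobSq (X * Ah - X * A) = u ^ 2 := (Real.sq_sqrt (frobSq_nonneg _)).symm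
  have hv2 : frobSq (X * B - X * A) = v ^ 2 := (Real.sq_sqrt (frobSq_nonneg _)).symm
  rw [hu2, hv2] at h
  rw [hu2, hv2]
  have hD : s * √((Ah - B).rank : ℝ) * √(frobSq (X * (Ah - B))) ≤
      s * √((Ah.rank : ℝ) + B.rank) * (u + v) := by
    gcongr
  have := quadratic_oracle hθ hc (u := u) (v := v) (D := s * √((Ah.rank : ℝ) + B.rank))
    (P := adaptivePen θ ξ δ X (X * A + E) B - adaptivePen θ ξ δ X (X * A + E) Ah) (by linarith)
  rwa [mul_pow, Real.sq_sqrt (by positivity : (0 : ℝ) ≤ (Ah.rank : ℝ) + B.rank)] at this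

end Oracle

section Main

variable {m n p : ℕ}

/-- The rotated and standardized noise: its components along and orthogonal to the column space. -/
noncomputable def noiseBlocks {a d : Type*} [Fintype a] [Fintype d] (σ : ℝ)
    (b : OrthonormalBasis (a ⊕ d) ℝ (EuclideanSpace ℝ (Fin m))) (E : Matrix (Fin m) (Fin n) ℝ) :
    (a × Fin n → ℝ) × (d × Fin n → ℝ) :=
  (fun k => ∑ i, b (Sum.inl k.1) i * (E i k.2 / σ),
    fun k => ∑ i, b (Sum.inr k.1) i * (E i k.2 / σ))

theorem colCoord_eq_mul_sum {ι : Type*} {σ : ℝ} (hσ : σ ≠ 0)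
    (b : ι → EuclideanSpace ℝ (Fin m)) (E : Matrix (Fin m) (Fin n) ℝ) (k : ι × Fin n) :
    colCoord b E k = σ * ∑ i, b k.1 i * (E i k.2 / σ) := by
  rw [colCoord, PiLp.inner_apply, Finset.mul_sum]
  refine Finset.sum_congr rfl fun i _ => ?_
  simp only [colVec, RCLike.inner_apply, conj_trivial]
  field_simp

theorem specNorm_const_mul {a b : Type*} [Fintype a] [Fintype b] [DecidableEq b] {σ : ℝ}
    (hσ : 0 ≤ σ) (G : a × b → ℝ) : specNorm (fun k => σ * G k) ≤ σ * specNorm G := by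
  refine specNorm_le_of_bilinPair_le (mul_nonneg hσ (specNorm_nonneg G)) fun v u hv hu => ?_
  have : bilinPair (fun k => σ * G k) v u = σ * bilinPair G v u := by
    rw [bilinPair, bilinPair, Finset.mul_sum]
    exact Finset.sum_congr rfl fun k _ => by ring
  rw [this]
  have h := bilinPair_le_specNorm G v u
  rw [hv, hu, mul_one, mul_one] at h
  exact mul_le_mul_of_nonneg_left h hσ

theorem hasLaw_noiseBlocks {Ω : Type*} [MeasurableSpace Ω] {Pr : Measure Ω}
    [IsProbabilityMeasure Pr] {a d : Type*} [Fintype a] [Fintype d] (hm : 0 < m) (hn : 0 < n)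
    {σ : ℝ≥0} (hσ : 0 < σ) {E : Ω → Matrix (Fin m) (Fin n) ℝ}
    (hE_law : ∀ i j, HasLaw (fun ω => E ω i j) (gaussianReal 0 (σ ^ 2)) Pr)
    (hE_indep : iIndepFun (fun (ij : Fin m × Fin n) (ω : Ω) => E ω ij.1 ij.2) Pr)
    (b : OrthonormalBasis (a ⊕ d) ℝ (EuclideanSpace ℝ (Fin m))) :
    HasLaw (fun ω => noiseBlocks σ b (E ω))
      ((gaussPi (a × Fin n)).prod (gaussPi (d × Fin n))) Pr := by
  have h1 := map_standardized_noise hσ hE_law hE_indep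
  have hae : AEMeasurable (fun ω (ij : Fin m × Fin n) => E ω ij.1 ij.2 / (σ : ℝ)) Pr :=
    aemeasurable_pi_lambda _ fun ij => (hE_law ij.1 ij.2).aemeasurable.div_const _
  let Φ : (Fin m × Fin n → ℝ) → (a × Fin n → ℝ) × (d × Fin n → ℝ) := fun g =>
      ((fun k : a × Fin n => ∑ i, b (Sum.inl k.1) i * g (i, k.2)),
        (fun k : d × Fin n => ∑ i, b (Sum.inr k.1) i * g (i, k.2)))
  have hΦ : Measurable Φ := by fun_prop
  refine ⟨hΦ.comp_aemeasurable hae, ?_⟩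
  rw [← map_gaussPi_blocks hm hn b, ← h1,
    AEMeasurable.map_map_of_aemeasurable hΦ.aemeasurable hae]
  rfl

theorem varEst_eq {X : Matrix (Fin m) (Fin p) ℝ} (hq : X.rank ≤ m) {σ : ℝ} (hσ : σ ≠ 0)
    {b : OrthonormalBasis (Fin X.rank ⊕ Fin (m - X.rank)) ℝ (EuclideanSpace ℝ (Fin m))}
    (hl : ∀ i, b (Sum.inl i) ∈ LinearMap.range (Matrix.toEuclideanLin X))
    (hr : ∀ i, b (Sum.inr i) ∈ (LinearMap.range (Matrix.toEuclideanLin X))ᗮ)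
    (A : Matrix (Fin p) (Fin n) ℝ) (E : Matrix (Fin m) (Fin n) ℝ) :
    varEst X (X * A + E) = σ ^ 2 * ((∑ k, (noiseBlocks σ b E).2 k ^ 2) /
      Fintype.card (Fin (m - X.rank) × Fin n)) := by
  rw [varEst, frobSq_sub_colProj_mul hl hr, Fintype.card_prod, Fintype.card_fin, Fintype.card_fin,
    Nat.cast_mul, Nat.cast_sub hq, ← sub_mul, ← mul_div_assoc, Finset.mul_sum]
  congr 1
  refine Finset.sum_congr rfl fun k _ => ?_
  rw [colCoord_eq_mul_sum hσ, mul_pow]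
  rfl

/-- The pathwise oracle inequality in terms of the standardized noise. -/
theorem frobSq_le_noise {X : Matrix (Fin m) (Fin p) ℝ} (hq : X.rank ≤ m) {σ : ℝ} (hσ : 0 < σ)
    {b : OrthonormalBasis (Fin X.rank ⊕ Fin (m - X.rank)) ℝ (EuclideanSpace ℝ (Fin m))}
    (hl : ∀ i, b (Sum.inl i) ∈ LinearMap.range (Matrix.toEuclideanLin X))
    (hr : ∀ i, b (Sum.inr i) ∈ (LinearMap.range (Matrix.toEuclideanLin X))ᗮ)
    {A : Matrix (Fin p) (Fin n) ℝ} {E : Matrix (Fin m) (Fin n) ℝ} {Ah : Matrix (Fin p) (Fin n) ℝ}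
    {θ ξ δ c : ℝ} (hθ : 0 < θ) (hδ1 : δ < 1) (hc : c = 1 + 2 / θ)
    (hmin : IsAdaptiveRSC θ ξ δ X (X * A + E) Ah) (k : ℕ) :
    frobSq (X * Ah - X * A) ≤ c ^ 2 * tailSingSq (X * A) k +
      2 * ((1 + θ) / (1 - δ)) * c * (1 + ξ) ^ 2 * σ ^ 2 * (√(n : ℝ) + √(X.rank : ℝ)) ^ 2 * k *
        ((∑ k, (noiseBlocks σ b E).2 k ^ 2) / Fintype.card (Fin (m - X.rank) × Fin n)) +
      2 * (1 + θ) * c * (min n p : ℕ) * σ ^ 2 * normExcess ξ δ (noiseBlocks σ b E) := by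
  obtain ⟨B, hBk, hB⟩ := exists_rank_le_frobSq_eq_tailSingSq X A k
  set G := (noiseBlocks σ b E).1 with hG
  set S := (∑ k, (noiseBlocks σ b E).2 k ^ 2) / (Fintype.card (Fin (m - X.rank) × Fin n) : ℝ)
    with hS
  set K : ℝ := √(n : ℝ) + √(X.rank : ℝ) with hK
  have hS0 : 0 ≤ S := div_nonneg (Finset.sum_nonneg fun _ _ => sq_nonneg _) (Nat.cast_nonneg _)
  have hc0 : 0 < c := by rw [hc]; positivity
  have h1δ : 0 < 1 - δ := by linarith
  have hdual : ∀ D : Matrix (Fin p) (Fin n) ℝ, ∑ i, ∑ j, E i j * (X * D) i j ≤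
      (σ * specNorm G) * √(D.rank : ℝ) * √(frobSq (X * D)) := by
    intro D
    refine (sum_mul_le_specNorm_colCoord hr E D).trans ?_
    have e : colCoord (fun i => b (Sum.inl i)) E = fun k => σ * G k := by
      funext k
      exact colCoord_eq_mul_sum hσ.ne' _ E k
    rw [e]
    have := specNorm_const_mul hσ.le G
    gcongr
  have h := frobSq_le_of_isAdaptiveRSC hθ hc hmin (mul_nonneg hσ.le (specNorm_nonneg G)) hdual B
  rw [hB] at h
  have hpen : ∀ C : Matrix (Fin p) (Fin n) ℝ, adaptivePen θ ξ δ X (X * A + E) C =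
      (1 + θ) * ((1 + ξ) ^ 2 * K ^ 2 / (1 - δ) * S) * σ ^ 2 * C.rank := by
    intro C
    rw [adaptivePen, varEst_eq hq hσ.ne' hl hr, ← hS, ← hK]
    ring
  rw [hpen, hpen] at h
  set W := (1 + ξ) ^ 2 * K ^ 2 / (1 - δ) * S with hW
  have hW0 : 0 ≤ W := by positivity
  have hexc : normExcess ξ δ (noiseBlocks σ b E) = max 0 (specNorm G ^ 2 - W) := by
    rw [normExcess, hW, hS, hG, hK]
    simp only [Fintype.card_fin]
  have hrk : ∀ C : Matrix (Fin p) (Fin n) ℝ, (C.rank : ℝ) ≤ (min n p : ℕ) := fun C => by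
    exact_mod_cast le_min C.rank_le_width C.rank_le_height
  rw [hexc]
  set M := max 0 (specNorm G ^ 2 - W) with hM
  have hM0 : 0 ≤ M := le_max_left _ _
  have hM1 : specNorm G ^ 2 - W ≤ M := le_max_right _ _
  have hR0 : (0 : ℝ) ≤ (Ah.rank : ℝ) + B.rank := by positivity
  have hR1 : (Ah.rank : ℝ) + B.rank ≤ 2 * (min n p : ℕ) := by linarith [hrk Ah, hrk B]
  have hkB : (B.rank : ℝ) ≤ k := by exact_mod_cast hBk
  have s1 : (specNorm G ^ 2 - W) * ((Ah.rank : ℝ) + B.rank) ≤ M * (2 * (min n p : ℕ)) :=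
    (mul_le_mul_of_nonneg_right hM1 hR0).trans (mul_le_mul_of_nonneg_left hR1 hM0)
  have s2 : W * (B.rank : ℝ) ≤ W * k := mul_le_mul_of_nonneg_left hkB hW0
  have hf : 0 ≤ c * (1 + θ) * σ ^ 2 := by positivity
  have t1 := mul_le_mul_of_nonneg_left s1 hf
  have t2 := mul_le_mul_of_nonneg_left s2 hf
  have e1 : 2 * ((1 + θ) / (1 - δ)) * c * (1 + ξ) ^ 2 * σ ^ 2 * K ^ 2 * k * S =
      2 * (c * (1 + θ) * σ ^ 2 * (W * k)) := by rw [hW]; ring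
  rw [e1]
  refine h.trans ?_
  have e2 : c ^ 2 * tailSingSq (X * A) k +
      c * (1 + θ) * ((σ * specNorm G) ^ 2 * ((Ah.rank : ℝ) + B.rank)) +
      c * ((1 + θ) * W * σ ^ 2 * (B.rank : ℝ) - (1 + θ) * W * σ ^ 2 * (Ah.rank : ℝ)) =
      c ^ 2 * tailSingSq (X * A) k +
      c * (1 + θ) * σ ^ 2 * ((specNorm G ^ 2 - W) * ((Ah.rank : ℝ) + B.rank)) +
      2 * (c * (1 + θ) * σ ^ 2 * (W * (B.rank : ℝ))) := by ring
  rw [e2]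
  linarith

end Main

theorem theorem9 {Ω : Type*} [MeasurableSpace Ω] (Pr : Measure Ω) [IsProbabilityMeasure Pr]
    {m n p : ℕ} (hn : 1 ≤ n) (hp : 1 ≤ p)
    (X : Matrix (Fin m) (Fin p) ℝ) (hq : X.rank < m)
    (A : Matrix (Fin p) (Fin n) ℝ)
    (σ : ℝ≥0) (hσ : 0 < σ)
    (E : Ω → Matrix (Fin m) (Fin n) ℝ)
    (hE_law : ∀ i j, HasLaw (fun ω => E ω i j) (gaussianReal 0 (σ ^ 2)) Pr)
    (hE_indep : iIndepFun (fun (ij : Fin m × Fin n) (ω : Ω) => E ω ij.1 ij.2) Pr)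
    (θ ξ δ : ℝ) (hθ : 0 < θ) (hξ : 0 < ξ) (hδ0 : 0 < δ) (hδ1 : δ < 1)
    (Ahat : Ω → Matrix (Fin p) (Fin n) ℝ)
    (hA_meas : ∀ i j, AEMeasurable (fun ω => Ahat ω i j) Pr)
    (hA_min : ∀ᵐ ω ∂Pr, IsAdaptiveRSC θ ξ δ X (X * A + E ω) (Ahat ω))
    (c : ℝ) (hc : c = 1 + 2 / θ) (q : ℕ) (hq_def : q = X.rank) :
    Integrable (fun ω => frobSq (X * Ahat ω - X * A)) Pr ∧
    ∫ ω, frobSq (X * Ahat ω - X * A) ∂Pr ≤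
      (Finset.Icc 1 (min n p)).inf' (Finset.nonempty_Icc.mpr (le_min hn hp))
        (fun k : ℕ => c ^ 2 * tailSingSq (X * A) k +
          2 * ((1 + θ) / (1 - δ)) * c * (1 + ξ) ^ 2 * (σ : ℝ) ^ 2 *
            (√(n : ℝ) + √(q : ℝ)) ^ 2 * (k : ℝ))
      + 4 * (1 + θ) * c * (min n p : ℕ) * (σ : ℝ) ^ 2 * (1 + ξ⁻¹) *
          Real.exp (-(ξ ^ 2 * ((n : ℝ) + q) / 2))
      + 4 * (1 + θ) * c * (min n p : ℕ) * (σ : ℝ) ^ 2 *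
          (2 + (√(n : ℝ) + √(q : ℝ)) ^ 2 + (√(n : ℝ) + √(q : ℝ)) * √(2 * Real.pi)) *
          Real.exp (-(δ ^ 2 * n * ((m : ℝ) - q) / (4 * (1 + δ)))) := by
  subst hq_def
  have hm : 0 < m := lt_of_le_of_lt (Nat.zero_le _) hq
  obtain ⟨b, hl, hr⟩ := exists_orthonormalBasis_range hm X
  have hσ' : (0 : ℝ) < σ := by exact_mod_cast hσ
  have hc0 : 0 < c := by rw [hc]; positivity
  have : Nonempty (Fin n) := ⟨⟨0, hn⟩⟩
  have : Nonempty (Fin (m - X.rank)) := ⟨⟨0, Nat.sub_pos_of_lt hq⟩⟩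
  set ν := (gaussPi (Fin X.rank × Fin n)).prod (gaussPi (Fin (m - X.rank) × Fin n)) with hν
  set N : ℝ := (Fintype.card (Fin (m - X.rank) × Fin n) : ℝ) with hN
  have hN0 : 0 < N := by rw [hN]; exact_mod_cast Fintype.card_pos
  have hlaw : HasLaw (fun ω => noiseBlocks σ b (E ω)) ν Pr :=
    hasLaw_noiseBlocks hm hn hσ hE_law hE_indep b
  have iS : Integrable (fun z : (Fin X.rank × Fin n → ℝ) × (Fin (m - X.rank) × Fin n → ℝ) =>
      (∑ k, z.2 k ^ 2) / N) ν :=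
    Integrable.div_const ((integrable_finsetSum Finset.univ fun k _ =>
      integrable_sq_coord_gaussPi k).comp_snd _) _
  have eS : ∫ z, (∑ k, z.2 k ^ 2) / N ∂ν = 1 := by
    have h := integral_prod_mul (μ := gaussPi (Fin X.rank × Fin n))
      (ν := gaussPi (Fin (m - X.rank) × Fin n)) (fun _ => (1 : ℝ))
      (fun h : Fin (m - X.rank) × Fin n → ℝ => ∑ k, h k ^ 2)
    simp only [one_mul, integral_const, probReal_univ, smul_eq_mul, integral_sum_sq_gaussPi] at h
    rw [integral_div, h, ← hN, div_self hN0.ne']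
  have iX : Integrable (normExcess ξ δ) ν := integrable_normExcess ξ δ
  set K : ℝ := √(n : ℝ) + √(X.rank : ℝ) with hK
  set c₂ : ℝ := 2 * (1 + θ) * c * (min n p : ℕ) * (σ : ℝ) ^ 2 with hc₂
  let c₁ : ℕ → ℝ := fun k => 2 * ((1 + θ) / (1 - δ)) * c * (1 + ξ) ^ 2 * (σ : ℝ) ^ 2 * K ^ 2 * k
  let F : ℕ → (Fin X.rank × Fin n → ℝ) × (Fin (m - X.rank) × Fin n → ℝ) → ℝ := fun k z =>
    c ^ 2 * tailSingSq (X * A) k + c₁ k * ((∑ k, z.2 k ^ 2) / N) + c₂ * normExcess ξ δ z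
  have iF : ∀ k, Integrable (F k) ν := fun k =>
    ((integrable_const _).add (iS.const_mul _)).add (iX.const_mul _)
  have eF : ∀ k, ∫ z, F k z ∂ν =
      c ^ 2 * tailSingSq (X * A) k + c₁ k + c₂ * ∫ z, normExcess ξ δ z ∂ν := by
    intro k
    have h1 : Integrable (fun z : (Fin X.rank × Fin n → ℝ) × (Fin (m - X.rank) × Fin n → ℝ) =>
        c ^ 2 * tailSingSq (X * A) k + c₁ k * ((∑ k, z.2 k ^ 2) / N)) ν :=
      (integrable_const _).add (iS.const_mul _)
    rw [integral_add h1 (iX.const_mul _), integral_add (integrable_const _) (iS.const_mul _),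
      integral_const_mul, integral_const_mul, eS]
    simp [integral_const_mul]
  have iFω : ∀ k, Integrable (fun ω => F k (noiseBlocks σ b (E ω))) Pr := fun k => by
    have h := iF k
    rw [← hlaw.map_eq] at h
    exact h.comp_aemeasurable hlaw.aemeasurable
  have eFω : ∀ k, ∫ ω, F k (noiseBlocks σ b (E ω)) ∂Pr = ∫ z, F k z ∂ν := fun k => by
    rw [← hlaw.map_eq, integral_map hlaw.aemeasurable]
    rw [hlaw.map_eq]; exact (iF k).aestronglyMeasurable
  have hle : ∀ k, ∀ᵐ ω ∂Pr, frobSq (X * Ahat ω - X * A) ≤ F k (noiseBlocks σ b (E ω)) := by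
    intro k
    filter_upwards [hA_min] with ω hω
    exact frobSq_le_noise hq.le hσ' hl hr hθ hδ1 hc hω k
  have hmeas : AEStronglyMeasurable (fun ω => frobSq (X * Ahat ω - X * A)) Pr := by
    refine AEMeasurable.aestronglyMeasurable ?_
    simp only [frobSq, Matrix.sub_apply, Matrix.mul_apply]
    exact Finset.aemeasurable_fun_sum _ fun i _ => Finset.aemeasurable_fun_sum _ fun j _ =>
      ((Finset.aemeasurable_fun_sum _ fun l _ => (hA_meas l j).const_mul _).sub_const _).pow_const _
  have hint : Integrable (fun ω => frobSq (X * Ahat ω - X * A)) Pr := by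
    refine (iFω 1).mono' hmeas ?_
    filter_upwards [hle 1] with ω hω
    rwa [Real.norm_eq_abs, abs_of_nonneg (frobSq_nonneg _)]
  refine ⟨hint, ?_⟩
  have hexc := integral_normExcess_le (a := Fin X.rank) (b := Fin n) (d := Fin (m - X.rank))
    hξ hδ0 hδ1
  simp only [Fintype.card_fin, Fintype.card_prod, Nat.cast_mul, Nat.cast_sub hq.le] at hexc
  rw [← hK, ← hν] at hexc
  have hK0 : 0 ≤ K := by positivity
  have hpi : 2 ≤ √(2 * Real.pi) := by
    refine Real.le_sqrt_of_sq_le ?_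
    nlinarith [Real.pi_gt_three]
  have hmq : (0 : ℝ) ≤ m - X.rank := sub_nonneg.2 (by exact_mod_cast hq.le)
  have hexp : Real.exp (-(δ ^ 2 * (((m : ℝ) - X.rank) * n) / 4)) ≤
      Real.exp (-(δ ^ 2 * n * ((m : ℝ) - X.rank) / (4 * (1 + δ)))) := by
    refine Real.exp_le_exp.2 (neg_le_neg ?_)
    have h0 : 0 ≤ δ ^ 2 * n * ((m : ℝ) - X.rank) := by positivity
    rw [show δ ^ 2 * (((m : ℝ) - X.rank) * n) = δ ^ 2 * n * ((m : ℝ) - X.rank) by ring]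
    exact div_le_div_of_nonneg_left h0 (by norm_num) (by linarith)
  have hcoef : K ^ 2 + 2 * K + 2 ≤ 2 * (2 + K ^ 2 + K * √(2 * Real.pi)) := by
    nlinarith [mul_le_mul_of_nonneg_left hpi hK0, sq_nonneg K]
  have hrest : c₂ * ∫ z, normExcess ξ δ z ∂ν ≤
      4 * (1 + θ) * c * (min n p : ℕ) * (σ : ℝ) ^ 2 * (1 + ξ⁻¹) *
          Real.exp (-(ξ ^ 2 * ((n : ℝ) + X.rank) / 2))
      + 4 * (1 + θ) * c * (min n p : ℕ) * (σ : ℝ) ^ 2 * (2 + K ^ 2 + K * √(2 * Real.pi)) *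
          Real.exp (-(δ ^ 2 * n * ((m : ℝ) - X.rank) / (4 * (1 + δ)))) := by
    have hc₂0 : 0 ≤ c₂ := by positivity
    have h2 := mul_le_mul hcoef hexp (Real.exp_pos _).le (by positivity)
    refine (mul_le_mul_of_nonneg_left (hexc.trans (add_le_add_right h2 _)) hc₂0).trans
      (le_of_eq ?_)
    rw [hc₂]
    ring
  rw [add_assoc]
  refine le_trans ?_ (add_le_add_right hrest _)
  rw [← sub_le_iff_le_add]
  refine Finset.le_inf' _ _ fun k _ => ?_
  rw [sub_le_iff_le_add]
  refine (integral_mono_ae hint (iFω k) (hle k)).trans (le_of_eq ?_)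
  rw [eFω, eF]
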